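/- Let $\widehat f(\xi)=\int_{\mathbb R^3}e^{-ix\cdot\xi}f(x)\,dx$ be the Fourier transform on $\mathbb R^3$ (extended to $L^2(\mathbb R^3;\mathbb C)$ by Plancherel). Fix an even real-valued function $\chi\in C_0^\infty((-2,2))$ with $\chi(s)=1$ for $|s|\le 1$, and set $\rho_1(s)=\chi(s)$ and $\rho_\lambda(s)=\chi(s/\lambda)-\chi(2s/\lambda)$ for $\lambda>1$. For dyadic $\lambda\ge 1$ (that is, $\lambda=2^k$ with $k\in\mathbb Z$, $k\ge 0$) let $P_\lambda$ be the Fourier multiplier with symbol $\rho_\lambda(|\xi|)$, and write $f_\lambda=P_\lambda f$. For $m\ge 0$ and $t\in\mathbb R$ let $S_m(t)$ be the Fourier multiplier on $L^2(\mathbb R^3;\mathbb C)$ with symbol $e^{-it\sqrt{m^2+|\xi|^2}}$. Let $m\ge 0$ and let $K>1$. There is a constant $C>0$, depending only on $m$, $K$ and $\chi$, such that for all dyadic $\mu,\lambda_1,\lambda_2\ge 1$ and all $f,g\in L^2(\mathbb R^3;\mathbb C)$ the functions of $(t,x)$ on the left-hand sides belong to $L^2(\mathbb R^{1+3})$ in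 the cases indicated, and the following bounds hold. (i) ($++$ interaction) $$\bigl\|P_\mu\bigl(S_m(t)f_{\lambda_1}\cdot S_m(t)g_{\lambda_2}\bigr)\bigr\|_{L^2_{t,x}(\mathbb R^{1+3})}\le \begin{cases} C\min(\lambda_1,\lambda_2)\,\|f_{\lambda_1}\|_{L^2}\|g_{\lambda_2}\|_{L^2} & \text{if } K\lambda_1\le\lambda_2\text{ or }K\lambda_2\le\lambda_1,\\ C\,\mu\,\|f_{\lambda_1}\|_{L^2}\|g_{\lambda_2}\|_{L^2} & \text{if } \mu\le K\lambda_1 \text{ and } K^{-1}\lambda_2\le\lambda_1\le K\lambda_2.\end{cases}$$ (ii) ($+-$ interaction) $$\bigl\|P_\mu\bigl(S_m(t)f_{\lambda_1}\cdot S_m(-t)g_{\lambda_2}\bigr)\bigr\|_{L^2_{t,x}(\mathbb R^{1+3})}\le \begin{cases} C\min(\lambda_1,\lambda_2)\,\|f_{\lambda_1}\|_{L^2}\|g_{\lambda_2}\|_{L^2} & \text{if } K\lambda_1\le\lambda_2\text{ or }K\lambda_2\le\lambda_1,\\ C\,\mu^{1/2}\lambda_1^{1/2}\,\|f_{\lambda_1}\|_{L^2}\|g_{\lambda_2}\|_{L^2}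 & \text{if } \mu\le K\lambda_1 \text{ and } K^{-1}\lambda_2\le\lambda_1\le K\lambda_2.\end{cases}$$ -/

import Mathlib

open MeasureTheory
open scoped FourierTransform ENNReal

noncomputable section

namespace KleinGordon

/-- The space `ℝ³` with its Euclidean norm. -/
abbrev Space : Type := EuclideanSpace ℝ (Fin 3)

/-- The space `L²(ℝ³; ℂ)`. -/
abbrev L2 : Type := Lp (α := Space) ℂ 2 volume

/-- The even cut-off functions `χ ∈ C₀^∞((-2, 2))` with `χ = 1` on `[-1, 1]`. -/
structure Cutoff where
  toFun : ℝ → ℝ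
  contDiff : ContDiff ℝ (⊤ : ℕ∞) toFun
  hasCompactSupport : HasCompactSupport toFun
  tsupport_subset : tsupport toFun ⊆ Set.Ioo (-2) 2
  even : ∀ s, toFun (-s) = toFun s
  eq_one : ∀ s, |s| ≤ 1 → toFun s = 1

/-- The inhomogeneous dyadic cut-off `ρ_λ`. -/
def Cutoff.rho (χ : Cutoff) (lam s : ℝ) : ℝ :=
  if lam < 1 then 0
  else if lam = 1 then χ.toFun s
  else χ.toFun (s / lam) - χ.toFun (2 * s / lam)

/-- The dyadic numbers `2 ^ k`, `k ∈ ℤ`. -/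
def IsDyadic (lam : ℝ) : Prop := ∃ k : ℤ, lam = (2 : ℝ) ^ k

/-- The symbol `⟨ξ⟩_m = √(m² + |ξ|²)` as a function of `r = |ξ|`. -/
def japanese (m r : ℝ) : ℝ := Real.sqrt (m ^ 2 + r ^ 2)

/-- The symbol `ρ_λ(|ξ|)` of `P_λ`. Mathlib's Fourier transform has the kernel
`exp (-2πi ⟨x, ξ⟩)`, so the frequency with respect to the kernel `exp (-i ⟨x, ξ⟩)`
is `2πξ`. -/
def projSymbol (χ : Cutoff) (lam : ℝ) (ξ : Space) : ℂ :=
  (χ.rho lam (2 * Real.pi * ‖ξ‖) : ℂ)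

/-- The symbol `exp (-i t ⟨ξ⟩_m)` of `S_m(t)`, at the frequency `2πξ`. -/
def waveSymbol (m t : ℝ) (ξ : Space) : ℂ :=
  Complex.exp (((-(t * japanese m (2 * Real.pi * ‖ξ‖)) : ℝ) : ℂ) * Complex.I)

theorem Cutoff.continuous_rho (χ : Cutoff) (lam : ℝ) : Continuous (χ.rho lam) := by
  have h := χ.contDiff.continuous
  unfold Cutoff.rho
  split_ifs <;> fun_prop

theorem Cutoff.exists_rho_bound (χ : Cutoff) (lam : ℝ) : ∃ C, ∀ s, ‖χ.rho lam s‖ ≤ C := by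
  obtain ⟨C, hC⟩ := χ.hasCompactSupport.exists_bound_of_continuous χ.contDiff.continuous
  have hC0 : 0 ≤ C := (norm_nonneg _).trans (hC 0)
  refine ⟨C + C, fun s => ?_⟩
  unfold Cutoff.rho
  split_ifs
  · simpa using add_nonneg hC0 hC0
  · linarith [hC s]
  · exact (norm_sub_le _ _).trans (add_le_add (hC _) (hC _))

theorem memLp_projSymbol (χ : Cutoff) (lam : ℝ) : MemLp (projSymbol χ lam) ∞ volume := by
  obtain ⟨C, hC⟩ := χ.exists_rho_bound lam
  have h : Continuous (projSymbol χ lam) := by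
    have := χ.continuous_rho lam
    unfold projSymbol
    fun_prop
  refine memLp_top_of_bound h.aestronglyMeasurable C (Filter.Eventually.of_forall fun ξ => ?_)
  simpa [projSymbol] using hC (2 * Real.pi * ‖ξ‖)

theorem memLp_waveSymbol (m t : ℝ) : MemLp (waveSymbol m t) ∞ volume := by
  have h : Continuous (waveSymbol m t) := by
    unfold waveSymbol japanese
    fun_prop
  refine memLp_top_of_bound h.aestronglyMeasurable 1 (Filter.Eventually.of_forall fun ξ => ?_)
  exact (Complex.norm_exp_ofReal_mul_I _).le

/-- The Fourier multiplier `f ↦ 𝓕⁻¹ (a · 𝓕 f)` on `L²(ℝ³)` with bounded symbol `a`. -/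
def multiplier (a : Space → ℂ) (ha : MemLp a ∞ volume) (f : L2) : L2 :=
  𝓕⁻ ((ha.toLp a • 𝓕 f : L2) : L2)

/-- The frequency projection `P_λ` on `L²(ℝ³)`. -/
def proj (χ : Cutoff) (lam : ℝ) (f : L2) : L2 :=
  multiplier (projSymbol χ lam) (memLp_projSymbol χ lam) f

/-- The propagator `S_m(t) = exp (-i t ⟨D⟩_m)` on `L²(ℝ³)`. -/
def propagator (m t : ℝ) (f : L2) : L2 :=
  multiplier (waveSymbol m t) (memLp_waveSymbol m t) f

/-- The frequency projection `P_λ` on integrable functions, through Fourier integrals.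
It is applied below to the product of two functions in `L²(ℝ³)`. -/
def projFun (χ : Cutoff) (lam : ℝ) (u : Space → ℂ) : Space → ℂ :=
  𝓕⁻ (fun ξ : Space => projSymbol χ lam ξ * 𝓕 u ξ)

/-- The function `(t, x) ↦ P_μ (S_m(t) f · S_m(ε t) g) (x)`; the sign `ε = 1` gives the
(++) interaction and `ε = -1` the (+-) interaction. -/
def interaction (χ : Cutoff) (m mu ε : ℝ) (f g : L2) (p : ℝ × Space) : ℂ :=
  projFun χ mu (fun x => propagator m p.1 f x * propagator m (ε * p.1) g x) p.2

/-- `u ∈ L²(ℝ × ℝ³)` and `‖u‖ ≤ B`. -/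
def L2NormLe (u : ℝ × Space → ℂ) (B : ℝ) : Prop :=
  MemLp u 2 volume ∧ eLpNorm u 2 volume ≤ ENNReal.ofReal B

end KleinGordon

end

/-!
By Plancherel in `x` and duality in `t`, a bilinear estimate for free waves follows from a bound for
the density of the push-forward of Lebesgue measure under the resonance function
`η ↦ ω(η) + ω(ξ - η)`, restricted to the frequencies `η` which contribute to the output
frequency `ξ`. Complex conjugation of one factor turns the (+-) interaction into the (++) one
without changing the `L²` norm of the product.

If one factor has its frequencies at most `λ`, and in a ball of radius `h`, the density is `O(λ h)`:
with the first axis along `ξ`, the resonance function is, on each plane orthogonal to `ξ`, an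
increasing function of the square of the distance to the axis. With `h = λ` this gives the constant
`min(λ₁, λ₂)`. For output frequencies of size `μ` the inputs split into cells of side `μ`, each of
which interacts only with boundedly many others, so that `h = O(μ)` and the constant becomes
`(μ λ₁)^(1/2)`. In the (++) case with `μ` much smaller than `λ₁`, the frequencies `η` and `ξ - η`
are nearly opposite, the gradient of the resonance function in the direction of `η` is bounded
below, and the density is `O(μ²)`.
-/

noncomputable section

namespace KleinGordon

open scoped Convolution

/-! ### Fourier integrals of square-integrable functions -/

section Fourier

variable {V : Type*} [NormedAddCommGroup V] [InnerProductSpace ℝ V] [FiniteDimensional ℝ V]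
  [MeasurableSpace V] [BorelSpace V] {f g : V → ℂ}

theorem continuous_fourier (hf : Integrable f) : Continuous (𝓕 f) := by
  rw [← Real.fourierTransform_toLp (memLp_one_iff_integrable.2 hf)]
  exact BoundedContinuousFunction.continuous _

theorem continuous_fourierInv (hf : Integrable f) : Continuous (𝓕⁻ f) := by
  rw [← Real.Lp.fourierTransformInv_toLp (memLp_one_iff_integrable.2 hf)]
  exact BoundedContinuousFunction.continuous _

theorem integral_fourier_mul_eq (hf : Integrable f) (hg : Integrable g) :
    ∫ ξ, 𝓕 f ξ * g ξ = ∫ x, f x * 𝓕 g x := by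
  have h := VectorFourier.integral_fourierIntegral_smul_eq_flip (L := innerₗ V)
    Real.continuous_fourierChar (continuous_inner (𝕜 := ℝ) (E := V)) hf hg
  rwa [flip_innerₗ] at h

theorem integral_fourierInv_mul_eq (hf : Integrable f) (hg : Integrable g) :
    ∫ ξ, 𝓕⁻ f ξ * g ξ = ∫ x, f x * 𝓕⁻ g x := by
  rw [← integral_neg_eq_self]
  simp only [Real.fourierInv_eq_fourier_neg, neg_neg]
  rw [integral_fourier_mul_eq hf hg.comp_neg, ← Real.fourierInv_eq_fourier_comp_neg]
  simp only [Real.fourierInv_eq_fourier_neg]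

theorem ae_eq_of_integral_schwartz_mul_eq (hf : LocallyIntegrable f) (hg : LocallyIntegrable g)
    (h : ∀ φ : SchwartzMap V ℂ, ∫ x, φ x * f x = ∫ x, φ x * g x) : f =ᵐ[volume] g := by
  refine ae_eq_of_integral_contDiff_smul_eq hf hg fun φ hφ hφc => ?_
  have hφ' : HasCompactSupport fun x => (φ x : ℂ) :=
    hφc.comp_left (g := ((↑) : ℝ → ℂ)) Complex.ofReal_zero
  exact h (hφ'.toSchwartzMap (Complex.ofRealCLM.contDiff.comp hφ))

theorem fourier_toLp_ae_eq (h1 : Integrable f) (h2 : MemLp f 2 volume) :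
    (𝓕 (h2.toLp f) : Lp (α := V) ℂ 2 volume) =ᵐ[volume] 𝓕 f := by
  refine ae_eq_of_integral_schwartz_mul_eq ((Lp.memLp _).locallyIntegrable (by norm_num))
    (continuous_fourier h1).locallyIntegrable fun φ => ?_
  have key := congrArg (fun T : TemperedDistribution V ℂ => T φ)
    (Lp.fourier_toTemperedDistribution_eq (h2.toLp f))
  simp only [TemperedDistribution.fourier_apply, Lp.toTemperedDistribution_apply,
    smul_eq_mul, SchwartzMap.fourier_coe] at key
  rw [← key, ← integral_fourier_mul_eq φ.integrable h1]
  exact integral_congr_ae (h2.coeFn_toLp.mono fun x hx => congrArg _ hx)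

theorem fourierInv_toLp_ae_eq (h1 : Integrable f) (h2 : MemLp f 2 volume) :
    (𝓕⁻ (h2.toLp f) : Lp (α := V) ℂ 2 volume) =ᵐ[volume] 𝓕⁻ f := by
  refine ae_eq_of_integral_schwartz_mul_eq ((Lp.memLp _).locallyIntegrable (by norm_num))
    (continuous_fourierInv h1).locallyIntegrable fun φ => ?_
  have key := congrArg (fun T : TemperedDistribution V ℂ => T φ)
    (Lp.fourierInv_toTemperedDistribution_eq (h2.toLp f))
  simp only [TemperedDistribution.fourierInv_apply, Lp.toTemperedDistribution_apply,
    smul_eq_mul, SchwartzMap.fourierInv_coe] at key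
  rw [← key, ← integral_fourierInv_mul_eq φ.integrable h1]
  exact integral_congr_ae (h2.coeFn_toLp.mono fun x hx => congrArg _ hx)

theorem eLpNorm_fourier_eq (h1 : Integrable f) (h2 : MemLp f 2 volume) :
    eLpNorm (𝓕 f) 2 volume = eLpNorm f 2 volume := by
  rw [← eLpNorm_congr_ae (fourier_toLp_ae_eq h1 h2), ← Lp.enorm_def, ← ofReal_norm,
    Lp.norm_fourier_eq, ofReal_norm, Lp.enorm_def, eLpNorm_congr_ae h2.coeFn_toLp]

theorem eLpNorm_fourierInv_eq (h1 : Integrable f) (h2 : MemLp f 2 volume) :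
    eLpNorm (𝓕⁻ f) 2 volume = eLpNorm f 2 volume := by
  have hneg : 𝓕⁻ f = 𝓕 f ∘ Neg.neg := funext fun x => Real.fourierInv_eq_fourier_neg f x
  rw [hneg, eLpNorm_comp_measurePreserving (continuous_fourier h1).aestronglyMeasurable
    (Measure.measurePreserving_neg volume), eLpNorm_fourier_eq h1 h2]

theorem memLp_fourierInv (h1 : Integrable f) (h2 : MemLp f 2 volume) :
    MemLp (𝓕⁻ f) 2 volume :=
  (memLp_congr_ae (fourierInv_toLp_ae_eq h1 h2)).1 (Lp.memLp _)

theorem enorm_convolution_le (hf : MemLp f 2 volume) (hg : MemLp g 2 volume) (ξ : V) :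
    ‖(f ⋆[ContinuousLinearMap.mul ℂ ℂ] g) ξ‖ₑ ≤ eLpNorm f 2 volume * eLpNorm g 2 volume := by
  have hξ := Measure.measurePreserving_sub_left volume ξ
  calc ‖(f ⋆[ContinuousLinearMap.mul ℂ ℂ] g) ξ‖ₑ
      ≤ eLpNorm (f • (g ∘ fun η => ξ - η)) 1 volume := by
        rw [eLpNorm_one_eq_lintegral_enorm, convolution_mul]
        exact enorm_integral_le_lintegral_enorm _
    _ ≤ eLpNorm f 2 volume * eLpNorm (g ∘ fun η => ξ - η) 2 volume :=
        eLpNorm_smul_le_mul_eLpNorm (hg.comp_measurePreserving hξ).1 hf.1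
    _ = eLpNorm f 2 volume * eLpNorm g 2 volume := by
        rw [eLpNorm_comp_measurePreserving hg.1 hξ]

theorem memLp_convolution (hf : Integrable f) (hf2 : MemLp f 2 volume)
    (hg : Integrable g) (hg2 : MemLp g 2 volume) :
    MemLp (f ⋆[ContinuousLinearMap.mul ℂ ℂ] g) 2 volume := by
  have hfg := hf.integrable_convolution (ContinuousLinearMap.mul ℂ ℂ) hg
  have hfin : eLpNorm f 2 volume * eLpNorm g 2 volume ≠ ∞ := ENNReal.mul_ne_top hf2.2.ne hg2.2.ne
  rw [memLp_two_iff_integrable_sq_norm hfg.1]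
  simp only [sq]
  refine hfg.norm.bdd_mul hfg.1.norm (c := (eLpNorm f 2 volume * eLpNorm g 2 volume).toReal)
    (ae_of_all _ fun ξ => ?_)
  rw [norm_norm, ← toReal_enorm]
  exact ENNReal.toReal_mono hfin (enorm_convolution_le hf2 hg2 ξ)

theorem fourierInv_convolution (hf : Integrable f) (hg : Integrable g) :
    𝓕⁻ (f ⋆[ContinuousLinearMap.mul ℂ ℂ] g) = 𝓕⁻ f * 𝓕⁻ g := by
  ext x
  simp only [Real.fourierInv_eq_fourier_neg, Pi.mul_apply, Real.fourier_mul_convolution_eq hf hg]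

theorem fourier_fourierInv_mul_ae_eq (hf : Integrable f) (hf2 : MemLp f 2 volume)
    (hg : Integrable g) (hg2 : MemLp g 2 volume) :
    𝓕 (𝓕⁻ f * 𝓕⁻ g) =ᵐ[volume] f ⋆[ContinuousLinearMap.mul ℂ ℂ] g := by
  have hc1 := hf.integrable_convolution (ContinuousLinearMap.mul ℂ ℂ) hg
  have hc2 := memLp_convolution hf hf2 hg hg2
  have hp1 : Integrable (𝓕⁻ f * 𝓕⁻ g) :=
    (memLp_fourierInv hf hf2).integrable_mul (memLp_fourierInv hg hg2)
  have hp2 : MemLp (𝓕⁻ f * 𝓕⁻ g) 2 volume := by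
    rw [← fourierInv_convolution hf hg]
    exact memLp_fourierInv hc1 hc2
  have hLp : hp2.toLp _ = 𝓕⁻ (hc2.toLp _) := by
    refine Lp.ext ?_
    filter_upwards [hp2.coeFn_toLp, fourierInv_toLp_ae_eq hc1 hc2] with x h1 h2
    rw [h1, h2, fourierInv_convolution hf hg]
  have h := fourier_toLp_ae_eq hp1 hp2
  rw [hLp, FourierTransform.fourier_fourierInv_eq] at h
  exact h.symm.trans hc2.coeFn_toLp

end Fourier

section Duality

variable {X : Type*} [MeasurableSpace X] {μ : Measure X}

theorem eLpNorm_two_sq {E : Type*} [NormedAddCommGroup E] (u : X → E) :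
    eLpNorm u 2 μ ^ 2 = ∫⁻ x, ‖u x‖ₑ ^ 2 ∂μ := by
  simpa using eLpNorm_nnreal_pow_eq_lintegral (μ := μ) (f := u) (p := 2) two_ne_zero

theorem eLpNorm_two_sq_eq_enorm_integral {k : X → ℂ} (hk : MemLp k 2 μ) :
    eLpNorm k 2 μ ^ 2 = ‖∫ x, (starRingEnd ℂ) (k x) * k x ∂μ‖ₑ := by
  have hsq : ∀ x, (starRingEnd ℂ) (k x) * k x = ((‖k x‖ ^ 2 : ℝ) : ℂ) := fun x => by
    rw [Complex.conj_mul', Complex.ofReal_pow]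
  have hnn : 0 ≤ ∫ x, ‖k x‖ ^ 2 ∂μ := integral_nonneg fun x => sq_nonneg _
  simp only [hsq]
  rw [integral_complex_ofReal, ← ofReal_norm, Complex.norm_of_nonneg hnn,
    ofReal_integral_eq_lintegral_ofReal ((memLp_two_iff_integrable_sq_norm hk.1).1 hk)
      (ae_of_all _ fun x => sq_nonneg _), eLpNorm_two_sq]
  exact lintegral_congr fun x => by rw [ENNReal.ofReal_pow (norm_nonneg _), ofReal_norm]

theorem eLpNorm_two_le_of_forall_indicator {u : X → ℂ} {S : ℕ → Set X}
    (hS : ∀ n, MeasurableSet (S n)) (hmono : Monotone S) (hunion : ⋃ n, S n = Set.univ)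
    {C : ℝ≥0∞} (h : ∀ n, eLpNorm ((S n).indicator u) 2 μ ≤ C) : eLpNorm u 2 μ ≤ C := by
  rw [← ENNReal.pow_le_pow_left_iff two_ne_zero, eLpNorm_two_sq, ← setLIntegral_univ, ← hunion,
    setLIntegral_iUnion_of_directed _ hmono.directed_le]
  refine iSup_le fun n => ?_
  rw [← eLpNorm_two_sq, ← eLpNorm_indicator_eq_eLpNorm_restrict (hS n)]
  gcongr
  exact h n

theorem eLpNorm_two_le_of_enorm_integral_mul_le [SigmaFinite μ] {u : X → ℂ}
    (hu : StronglyMeasurable u) {C : ℝ≥0∞}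
    (h : ∀ k, Integrable k μ → MemLp k 2 μ → ‖∫ x, k x * u x ∂μ‖ₑ ≤ C * eLpNorm k 2 μ) :
    eLpNorm u 2 μ ≤ C := by
  let S : ℕ → Set X := fun n => spanningSets μ n ∩ {x | ‖u x‖ ≤ n}
  have hS : ∀ n, MeasurableSet (S n) := fun n =>
    (measurableSet_spanningSets μ n).inter (measurableSet_le hu.norm.measurable measurable_const)
  have hmono_norm : Monotone fun n : ℕ => {x | ‖u x‖ ≤ n} := fun a b hab x hx =>
    le_trans (b := (a : ℝ)) hx (by exact_mod_cast hab)
  have hS_mono : Monotone S := (monotone_spanningSets μ).inter hmono_norm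
  have hS_univ : ⋃ n, S n = Set.univ := by
    rw [Set.iUnion_inter_of_monotone (monotone_spanningSets μ) hmono_norm, iUnion_spanningSets,
      Set.univ_inter, Set.iUnion_eq_univ_iff]
    exact fun x => exists_nat_ge ‖u x‖
  refine eLpNorm_two_le_of_forall_indicator hS hS_mono hS_univ fun n => ?_
  let k : X → ℂ := (S n).indicator u
  have hk : ∀ p, MemLp k p μ := fun p => by
    have : IsFiniteMeasure (μ.restrict (S n)) :=
      isFiniteMeasure_restrict.2 ((measure_mono Set.inter_subset_left).trans_lt
        (measure_spanningSets_lt_top μ n)).ne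
    exact (memLp_indicator_iff_restrict (hS n)).2 (MemLp.of_bound hu.aestronglyMeasurable n
      (ae_restrict_of_forall_mem (hS n) fun x hx => hx.2))
  have hpair : ∀ x, (starRingEnd ℂ) (k x) * k x = star k x * u x := fun x => by
    by_cases hx : x ∈ S n <;> simp [k, hx]
  have hle : eLpNorm k 2 μ * eLpNorm k 2 μ ≤ C * eLpNorm k 2 μ := by
    calc eLpNorm k 2 μ * eLpNorm k 2 μ = ‖∫ x, star k x * u x ∂μ‖ₑ := by
          rw [← sq, eLpNorm_two_sq_eq_enorm_integral (hk 2), integral_congr_ae (ae_of_all _ hpair)]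
      _ ≤ C * eLpNorm (star k) 2 μ :=
          h _ (memLp_one_iff_integrable.1 (hk 1).star) (hk 2).star
      _ = C * eLpNorm k 2 μ := by rw [eLpNorm_star]
  rcases eq_or_ne (eLpNorm k 2 μ) 0 with h0 | h0
  · exact h0.le.trans zero_le
  · exact (ENNReal.mul_le_mul_iff_left h0 (hk 2).2.ne).1 hle

variable {ν : Measure X} {ψ : X → ℝ} {h : X → ℂ}

/-- The oscillatory integral `∫ exp (-2πi t ψ) h dν` with phase `ψ` and amplitude `h`. -/
def oscInt (ν : Measure X) (ψ : X → ℝ) (h : X → ℂ) (t : ℝ) : ℂ :=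
  ∫ x, (Real.fourierChar (-(t * ψ x)) : ℂ) * h x ∂ν

theorem stronglyMeasurable_oscInt [SFinite ν] (hψ : Measurable ψ) (hh : StronglyMeasurable h) :
    StronglyMeasurable (oscInt ν ψ h) := by
  have hphase : Measurable fun p : ℝ × X => -(p.1 * ψ p.2) :=
    (measurable_fst.mul (hψ.comp measurable_snd)).neg
  have hchar : Continuous fun s : ℝ => (Real.fourierChar s : ℂ) := by fun_prop
  exact ((hchar.stronglyMeasurable.comp_measurable hphase).mul
    (hh.comp_measurable measurable_snd)).integral_prod_right'

theorem integral_mul_oscInt [SFinite ν] (hψ : Measurable ψ) (hh : Integrable h ν) {k : ℝ → ℂ}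
    (hk : Integrable k) :
    ∫ t, k t * oscInt ν ψ h t = ∫ x, 𝓕 k (ψ x) * h x ∂ν := by
  have hphase : Measurable fun p : ℝ × X => -(p.1 * ψ p.2) :=
    (measurable_fst.mul (hψ.comp measurable_snd)).neg
  have hchar : Continuous fun s : ℝ => (Real.fourierChar s : ℂ) := by fun_prop
  have hint : Integrable (fun p : ℝ × X =>
      k p.1 * ((Real.fourierChar (-(p.1 * ψ p.2)) : ℂ) * h p.2)) (volume.prod ν) := by
    refine (hk.mul_prod hh).mono ?_ (ae_of_all _ fun p => ?_)
    · exact hk.1.comp_fst.mul ((hchar.stronglyMeasurable.comp_measurable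
        hphase).aestronglyMeasurable.mul hh.1.comp_snd)
    · simp only [norm_mul, Circle.norm_coe, one_mul, le_refl]
  calc ∫ t, k t * oscInt ν ψ h t
      = ∫ t, ∫ x, k t * ((Real.fourierChar (-(t * ψ x)) : ℂ) * h x) ∂ν := by
        simp only [oscInt, integral_const_mul]
    _ = ∫ x, (∫ t : ℝ, k t * ((Real.fourierChar (-(t * ψ x)) : ℂ) * h x)) ∂ν :=
        integral_integral_swap hint
    _ = ∫ x, 𝓕 k (ψ x) * h x ∂ν := by
        refine integral_congr_ae (ae_of_all _ fun x => ?_)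
        simp only [Real.fourier_real_eq, Circle.smul_def, smul_eq_mul, ← integral_mul_const]
        exact integral_congr_ae (ae_of_all _ fun t => by ring)

theorem eLpNorm_two_comp_le_of_map_le (hψ : Measurable ψ) {N : ℝ≥0∞}
    (hmap : ν.map ψ ≤ N ^ 2 • volume) {k : ℝ → ℂ} (hk : StronglyMeasurable k) :
    eLpNorm (k ∘ ψ) 2 ν ≤ N * eLpNorm k 2 volume := by
  calc eLpNorm (k ∘ ψ) 2 ν = eLpNorm k 2 (ν.map ψ) :=
        (eLpNorm_map_measure hk.aestronglyMeasurable hψ.aemeasurable).symm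
    _ ≤ eLpNorm k 2 (N ^ 2 • volume) := eLpNorm_mono_measure k hmap
    _ = N * eLpNorm k 2 volume := by
        rw [eLpNorm_smul_measure_of_ne_top ENNReal.ofNat_ne_top, smul_eq_mul, ← ENNReal.rpow_ofNat,
          ← ENNReal.rpow_mul]
        norm_num

theorem eLpNorm_oscInt_le [SFinite ν] (hψ : Measurable ψ) (hsm : StronglyMeasurable h)
    (hh : Integrable h ν) {N : ℝ≥0∞}
    (hmap : (ν.restrict (Function.support h)).map ψ ≤ N ^ 2 • volume) :
    eLpNorm (oscInt ν ψ h) 2 volume ≤ N * eLpNorm h 2 ν := by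
  refine eLpNorm_two_le_of_enorm_integral_mul_le (stronglyMeasurable_oscInt hψ hsm)
    fun k hk1 hk2 => ?_
  have hFk : StronglyMeasurable (𝓕 k) := (continuous_fourier hk1).stronglyMeasurable
  calc ‖∫ t, k t * oscInt ν ψ h t‖ₑ
      = ‖∫ x in Function.support h, 𝓕 k (ψ x) * h x ∂ν‖ₑ := by
        rw [integral_mul_oscInt hψ hh hk1, setIntegral_eq_integral_of_forall_compl_eq_zero]
        intro x hx
        rw [Function.notMem_support.1 hx, mul_zero]
    _ ≤ eLpNorm ((𝓕 k ∘ ψ) • h) 1 (ν.restrict (Function.support h)) := by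
        rw [eLpNorm_one_eq_lintegral_enorm]
        exact enorm_integral_le_lintegral_enorm _
    _ ≤ eLpNorm (𝓕 k ∘ ψ) 2 (ν.restrict (Function.support h)) *
          eLpNorm h 2 (ν.restrict (Function.support h)) :=
        eLpNorm_smul_le_mul_eLpNorm hsm.aestronglyMeasurable
          (hFk.comp_measurable hψ).aestronglyMeasurable
    _ ≤ (N * eLpNorm (𝓕 k) 2 volume) * eLpNorm h 2 ν :=
        mul_le_mul' (eLpNorm_two_comp_le_of_map_le hψ hmap hFk)
          (eLpNorm_mono_measure h Measure.restrict_le_self)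
    _ = N * eLpNorm h 2 ν * eLpNorm k 2 volume := by
        rw [eLpNorm_fourier_eq hk1 hk2, mul_right_comm]

end Duality

/-! ### Products of free waves -/

section Product

variable {X Y : Type*} [MeasurableSpace X] [MeasurableSpace Y] {μ : Measure X} {ν : Measure Y}
  [SFinite ν] {u v : X × Y → ℂ}

theorem eLpNorm_two_prod_sq (hu : AEStronglyMeasurable u (μ.prod ν)) :
    eLpNorm u 2 (μ.prod ν) ^ 2 = ∫⁻ x, eLpNorm (fun y => u (x, y)) 2 ν ^ 2 ∂μ := by
  simp only [eLpNorm_two_sq]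
  exact lintegral_prod _ (hu.enorm.pow_const 2)

theorem eLpNorm_two_prod_sq_symm [SFinite μ] (hu : AEStronglyMeasurable u (μ.prod ν)) :
    eLpNorm u 2 (μ.prod ν) ^ 2 = ∫⁻ y, eLpNorm (fun x => u (x, y)) 2 μ ^ 2 ∂ν := by
  simp only [eLpNorm_two_sq]
  exact lintegral_prod_symm _ (hu.enorm.pow_const 2)

theorem eLpNorm_two_prod_le (hu : AEStronglyMeasurable u (μ.prod ν))
    (hv : AEStronglyMeasurable v (μ.prod ν))
    (h : ∀ x, eLpNorm (fun y => u (x, y)) 2 ν ≤ eLpNorm (fun y => v (x, y)) 2 ν) :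
    eLpNorm u 2 (μ.prod ν) ≤ eLpNorm v 2 (μ.prod ν) := by
  rw [← ENNReal.pow_le_pow_left_iff two_ne_zero, eLpNorm_two_prod_sq hu, eLpNorm_two_prod_sq hv]
  gcongr with x
  exact h x

end Product

section Evolve

/-- The free evolution `exp (-2πi t ω(ξ)) F(ξ)` with dispersion relation `ω`, on the Fourier
side. -/
def evolve {X : Type*} (ω : X → ℝ) (t : ℝ) (F : X → ℂ) (ξ : X) : ℂ :=
  (Real.fourierChar (-(t * ω ξ)) : ℂ) * F ξ

variable {X : Type*} {ω : X → ℝ} {F : X → ℂ}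

theorem enorm_evolve (ω : X → ℝ) (t : ℝ) (F : X → ℂ) (ξ : X) : ‖evolve ω t F ξ‖ₑ = ‖F ξ‖ₑ := by
  rw [evolve, enorm_mul, ← ofReal_norm, Circle.norm_coe, ENNReal.ofReal_one, one_mul]

theorem stronglyMeasurable_evolve_prod [MeasurableSpace X] (hω : Measurable ω)
    (hF : StronglyMeasurable F) :
    StronglyMeasurable fun p : ℝ × X => evolve ω p.1 F p.2 := by
  have hphase : Measurable fun p : ℝ × X => -(p.1 * ω p.2) :=
    (measurable_fst.mul (hω.comp measurable_snd)).neg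
  have hchar : Continuous fun s : ℝ => (Real.fourierChar s : ℂ) := by fun_prop
  exact (hchar.stronglyMeasurable.comp_measurable hphase).mul (hF.comp_measurable measurable_snd)

theorem stronglyMeasurable_evolve [MeasurableSpace X] (hω : Measurable ω) (t : ℝ)
    (hF : StronglyMeasurable F) :
    StronglyMeasurable (evolve ω t F) :=
  (stronglyMeasurable_evolve_prod hω hF).comp_measurable (g := fun ξ => (t, ξ))
    measurable_prodMk_left

end Evolve

section FreeWaves

variable {V : Type*} [NormedAddCommGroup V] [InnerProductSpace ℝ V] [FiniteDimensional ℝ V]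
  [MeasurableSpace V] [BorelSpace V] {F G : V → ℂ} {Λ Λ' : ℝ}

section Bandlimited

/-- The measurable square-integrable functions supported in the ball of radius `Λ`. On the Fourier
side these are the functions with frequencies at most `Λ`. -/
structure IsBandlimited (F : V → ℂ) (Λ : ℝ) : Prop where
  stronglyMeasurable : StronglyMeasurable F
  memLp : MemLp F 2 volume
  norm_le : ∀ η, F η ≠ 0 → ‖η‖ ≤ Λ

/-- The Fourier transform of the complex conjugate of the function with Fourier transform `F`. -/
def reflect (F : V → ℂ) (ξ : V) : ℂ := (starRingEnd ℂ) (F (-ξ))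

theorem eLpNorm_reflect (hF : AEStronglyMeasurable F volume) (p : ℝ≥0∞) :
    eLpNorm (reflect F) p volume = eLpNorm F p volume :=
  (eLpNorm_star (f := F ∘ Neg.neg)).trans
    (eLpNorm_comp_measurePreserving hF (Measure.measurePreserving_neg volume))

namespace IsBandlimited

theorem integrable (hF : IsBandlimited F Λ) : Integrable F := by
  have hsupp : Function.support F ⊆ Metric.closedBall 0 Λ := fun η hη => by
    simpa using hF.norm_le η hη
  rw [← integrableOn_iff_integrable_of_support_subset hsupp]
  have : IsFiniteMeasure (volume.restrict (Metric.closedBall (0 : V) Λ)) :=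
    ⟨by simpa using measure_closedBall_lt_top⟩
  exact (hF.memLp.restrict _).integrable one_le_two

theorem indicator (hF : IsBandlimited F Λ) {S : Set V} (hS : MeasurableSet S) :
    IsBandlimited (S.indicator F) Λ where
  stronglyMeasurable := hF.stronglyMeasurable.indicator hS
  memLp := hF.memLp.indicator hS
  norm_le η h := hF.norm_le η (Set.indicator_apply_ne_zero.1 h).2

theorem reflect (hF : IsBandlimited F Λ) : IsBandlimited (KleinGordon.reflect F) Λ where
  stronglyMeasurable :=
    Complex.continuous_conj.comp_stronglyMeasurable
      (hF.stronglyMeasurable.comp_measurable measurable_neg)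
  memLp := (hF.memLp.comp_measurePreserving (Measure.measurePreserving_neg volume)).star
  norm_le η h := by simpa using hF.norm_le (-η) (by simpa [KleinGordon.reflect] using h)

end IsBandlimited

end Bandlimited

section Evolution

/-- The Fourier transform in `x` of the product of the free wave with profile `F` and the free
wave with profile `G`, the latter run at speed `ε`. -/
def waveConv (ω : V → ℝ) (ε : ℝ) (F G : V → ℂ) (p : ℝ × V) : ℂ :=
  (evolve ω p.1 F ⋆[ContinuousLinearMap.mul ℂ ℂ] evolve ω (ε * p.1) G) p.2

variable {ω : V → ℝ} {t : ℝ}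

theorem stronglyMeasurable_waveConv (hω : Measurable ω) (ε : ℝ) (hF : StronglyMeasurable F)
    (hG : StronglyMeasurable G) : StronglyMeasurable (waveConv ω ε F G) := by
  have hF' := (stronglyMeasurable_evolve_prod hω hF).comp_measurable
    (g := fun q : (ℝ × V) × V => (q.1.1, q.2)) (by fun_prop)
  have hG' := (stronglyMeasurable_evolve_prod hω hG).comp_measurable
    (g := fun q : (ℝ × V) × V => (ε * q.1.1, q.1.2 - q.2)) (by fun_prop)
  exact (hF'.mul hG').integral_prod_right'

theorem IsBandlimited.evolve (hF : IsBandlimited F Λ) (hω : Measurable ω) (t : ℝ) :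
    IsBandlimited (KleinGordon.evolve ω t F) Λ where
  stronglyMeasurable := stronglyMeasurable_evolve hω t hF.stronglyMeasurable
  memLp := hF.memLp.congr_enorm
    (stronglyMeasurable_evolve hω t hF.stronglyMeasurable).aestronglyMeasurable
    (ae_of_all _ fun ξ => (enorm_evolve ω t F ξ).symm)
  norm_le η h := hF.norm_le η (right_ne_zero_of_mul h)

theorem waveConv_one_comm (ω : V → ℝ) (F G : V → ℂ) : waveConv ω 1 F G = waveConv ω 1 G F := by
  ext p
  rw [waveConv, waveConv, convolution_mul, convolution_mul_swap, one_mul]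
  exact integral_congr_ae (ae_of_all _ fun η => mul_comm _ _)

theorem waveConv_one_apply (ω : V → ℝ) (F G : V → ℂ) (t : ℝ) (ξ : V) :
    waveConv ω 1 F G (t, ξ) =
      oscInt volume (fun η => ω η + ω (ξ - η)) (fun η => F η * G (ξ - η)) t := by
  rw [waveConv, convolution_mul]
  refine integral_congr_ae (ae_of_all _ fun η => ?_)
  simp only [evolve, one_mul, mul_add, neg_add, AddChar.map_add_eq_mul, Circle.coe_mul]
  ring

theorem measurable_eLpNorm_mul_comp_sub_sq (hF : StronglyMeasurable F)
    (hG : StronglyMeasurable G) :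
    Measurable fun ξ => eLpNorm (fun η => F η * G (ξ - η)) 2 volume ^ 2 := by
  simp only [eLpNorm_two_sq]
  exact (((hF.comp_measurable measurable_snd).mul (hG.comp_measurable
    (measurable_fst.sub measurable_snd))).enorm.pow_const 2).lintegral_prod_right'

theorem lintegral_eLpNorm_mul_comp_sub_sq (hF : StronglyMeasurable F)
    (hG : StronglyMeasurable G) :
    ∫⁻ ξ, eLpNorm (fun η => F η * G (ξ - η)) 2 volume ^ 2 =
      (eLpNorm F 2 volume * eLpNorm G 2 volume) ^ 2 := by
  have hF' : Measurable fun η => ‖F η‖ₑ ^ 2 := hF.enorm.pow_const 2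
  have : Measurable fun η => ‖G η‖ₑ ^ 2 := hG.enorm.pow_const 2
  simp only [eLpNorm_two_sq, mul_pow, enorm_mul]
  rw [lintegral_lintegral_swap (by fun_prop), ← lintegral_mul_const _ hF']
  refine lintegral_congr fun η => ?_
  rw [lintegral_const_mul _ (by fun_prop), lintegral_sub_right_eq_self (fun ξ => ‖G ξ‖ₑ ^ 2) η]

/-- The resonance function `η ↦ ω(η) + ω(ξ - η)` is the phase of the time integral at output
frequency `ξ`; the constant is the square root of the density of its law. -/
theorem eLpNorm_waveConv_one_le (hω : Measurable ω) (hF : StronglyMeasurable F)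
    (hG : StronglyMeasurable G) (hF2 : MemLp F 2 volume) (hG2 : MemLp G 2 volume) {N : ℝ≥0∞}
    (hN : ∀ ξ, (volume.restrict {η | F η ≠ 0 ∧ G (ξ - η) ≠ 0}).map
      (fun η => ω η + ω (ξ - η)) ≤ N ^ 2 • volume) :
    eLpNorm (waveConv ω 1 F G) 2 volume ≤ N * (eLpNorm F 2 volume * eLpNorm G 2 volume) := by
  rw [← ENNReal.pow_le_pow_left_iff two_ne_zero, mul_pow, Measure.volume_eq_prod,
    eLpNorm_two_prod_sq_symm (stronglyMeasurable_waveConv hω 1 hF hG).aestronglyMeasurable,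
    ← lintegral_eLpNorm_mul_comp_sub_sq hF hG,
    ← lintegral_const_mul _ (measurable_eLpNorm_mul_comp_sub_sq hF hG)]
  refine lintegral_mono fun ξ => ?_
  have hGξ : MemLp (fun η => G (ξ - η)) 2 volume :=
    hG2.comp_measurePreserving (Measure.measurePreserving_sub_left volume ξ)
  have hsupp : Function.support (fun η => F η * G (ξ - η)) = {η | F η ≠ 0 ∧ G (ξ - η) ≠ 0} := by
    ext η
    simp
  simp only [waveConv_one_apply, ← mul_pow]
  gcongr
  exact eLpNorm_oscInt_le (by fun_prop) (hF.mul (hG.comp_measurable (by fun_prop)))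
    (hF2.integrable_mul hGξ) (hsupp ▸ hN ξ)

theorem fourierInv_evolve_reflect (hω : ∀ ξ, ω (-ξ) = ω ξ) (t : ℝ) (G : V → ℂ) (x : V) :
    𝓕⁻ (evolve ω t (reflect G)) x = (starRingEnd ℂ) (𝓕⁻ (evolve ω (-t) G) x) := by
  rw [Real.fourierInv_eq, Real.fourierInv_eq, ← integral_conj, ← integral_neg_eq_self]
  refine integral_congr_ae (ae_of_all _ fun η => ?_)
  simp only [evolve, reflect, hω, Circle.smul_def, smul_eq_mul, map_mul, neg_neg,
    inner_neg_left, neg_mul, AddChar.map_neg_eq_inv, Circle.coe_inv_eq_conj]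

theorem eLpNorm_waveConv_apply (hω : Measurable ω) (hF : IsBandlimited F Λ)
    (hG : IsBandlimited G Λ') (ε t : ℝ) :
    eLpNorm (fun ξ => waveConv ω ε F G (t, ξ)) 2 volume =
      eLpNorm (𝓕⁻ (evolve ω t F) * 𝓕⁻ (evolve ω (ε * t) G)) 2 volume := by
  have hFt := hF.evolve hω t
  have hGt := hG.evolve hω (ε * t)
  rw [← fourierInv_convolution hFt.integrable hGt.integrable]
  exact (eLpNorm_fourierInv_eq (hFt.integrable.integrable_convolution _ hGt.integrable)
    (memLp_convolution hFt.integrable hFt.memLp hGt.integrable hGt.memLp)).symm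

theorem eLpNorm_waveConv_neg_one (hω : Measurable ω) (hω_even : ∀ ξ, ω (-ξ) = ω ξ)
    (hF : IsBandlimited F Λ) (hG : IsBandlimited G Λ') :
    eLpNorm (waveConv ω (-1) F G) 2 volume = eLpNorm (waveConv ω 1 F (reflect G)) 2 volume := by
  have hmeas₁ := (stronglyMeasurable_waveConv hω (-1) hF.stronglyMeasurable
    hG.stronglyMeasurable).aestronglyMeasurable (μ := volume.prod volume)
  have hmeas₂ := (stronglyMeasurable_waveConv hω 1 hF.stronglyMeasurable
    hG.reflect.stronglyMeasurable).aestronglyMeasurable (μ := volume.prod volume)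
  rw [← (ENNReal.pow_right_strictMono two_ne_zero).injective.eq_iff,
    Measure.volume_eq_prod, eLpNorm_two_prod_sq hmeas₁,
    eLpNorm_two_prod_sq hmeas₂]
  refine lintegral_congr fun t => congrArg (· ^ 2) ?_
  rw [eLpNorm_waveConv_apply hω hF hG, eLpNorm_waveConv_apply hω hF hG.reflect]
  refine eLpNorm_congr_enorm_ae (ae_of_all _ fun x => ?_)
  simp [fourierInv_evolve_reflect hω_even]

end Evolution

end FreeWaves

/-! ### Density of the resonance function -/

section PushForward

open scoped NNReal

theorem map_restrict_le_of_expanding {S : Set ℝ} {g : ℝ → ℝ} (hg : Measurable g) {L : ℝ≥0}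
    (h : ∀ a ∈ S, ∀ b ∈ S, |a - b| ≤ L * |g a - g b|) :
    (volume.restrict S).map g ≤ (L : ℝ≥0∞) • volume := by
  refine Measure.le_iff.2 fun I hI => ?_
  rw [Measure.map_apply hg hI, Measure.restrict_apply (hg hI), Measure.smul_apply, smul_eq_mul]
  set T := g ⁻¹' I ∩ S
  have hinj : Set.InjOn g T := fun a ha b hb hab => by
    simpa [hab, sub_eq_zero] using h a ha.2 b hb.2
  have hinv : Set.LeftInvOn (Function.invFunOn g T) g T := hinj.leftInvOn_invFunOn
  have hlip : LipschitzOnWith L (Function.invFunOn g T) (g '' T) := by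
    refine LipschitzOnWith.of_dist_le_mul ?_
    rintro _ ⟨a, ha, rfl⟩ _ ⟨b, hb, rfl⟩
    rw [hinv ha, hinv hb]
    exact h a ha.2 b hb.2
  -- `T` is the image of `g '' T ⊆ I` under the `L`-Lipschitz inverse of `g`
  have hle := hlip.hausdorffMeasure_image_le (d := 1) zero_le_one
  rw [hinv.image_image, hausdorffMeasure_real, ENNReal.rpow_one] at hle
  refine hle.trans ?_
  gcongr
  exact Set.image_subset_iff.2 Set.inter_subset_left

theorem map_restrict_le_of_fibers {X Y Z : Type*} [MeasurableSpace X] [MeasurableSpace Y]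
    [MeasurableSpace Z] {μ : Measure X} {ν : Measure Y} {ρ : Measure Z} [SFinite ν]
    {T : X × Y → Z} (hT : MeasurePreserving T (μ.prod ν) ρ) {ψ : Z → ℝ} (hψ : Measurable ψ)
    {S : Set Z} (hS : MeasurableSet S) {A : Set X} (hA : ∀ x y, T (x, y) ∈ S → x ∈ A) {M : ℝ≥0∞}
    (hfib : ∀ x, (ν.restrict {y | T (x, y) ∈ S}).map (fun y => ψ (T (x, y))) ≤ M • volume) :
    (ρ.restrict S).map ψ ≤ (M * μ A) • volume := by
  refine Measure.le_iff.2 fun I hI => ?_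
  have hTS : MeasurableSet (T ⁻¹' (ψ ⁻¹' I ∩ S)) := hT.measurable ((hψ hI).inter hS)
  rw [Measure.map_apply hψ hI, Measure.restrict_apply (hψ hI), ← hT.measure_preimage
    ((hψ hI).inter hS).nullMeasurableSet, Measure.prod_apply hTS, Measure.smul_apply, smul_eq_mul]
  calc ∫⁻ x, ν (Prod.mk x ⁻¹' (T ⁻¹' (ψ ⁻¹' I ∩ S))) ∂μ
      ≤ ∫⁻ x, A.indicator (fun _ => M * volume I) x ∂μ := by
        refine lintegral_mono fun x => ?_
        by_cases hx : x ∈ A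
        · have hψx : Measurable fun y => ψ (T (x, y)) :=
            hψ.comp (hT.measurable.comp measurable_prodMk_left)
          have hle := hfib x I
          rwa [Measure.map_apply hψx hI, Measure.restrict_apply (hψx hI), Measure.smul_apply,
            smul_eq_mul, ← Set.indicator_of_mem hx (fun _ => M * volume I)] at hle
        · rw [Set.eq_empty_of_forall_notMem (s := Prod.mk x ⁻¹' _) fun y hy => hx (hA x y hy.2)]
          simp
    _ ≤ M * volume I * μ A := lintegral_indicator_const_le _ _
    _ = M * μ A * volume I := by ring

theorem map_norm_sq_plane :
    (volume : Measure (EuclideanSpace ℝ (Fin 2))).map (fun b => ‖b‖ ^ 2) =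
      ENNReal.ofReal Real.pi • volume.restrict (Set.Ioi 0) := by
  set ν := (volume : Measure (EuclideanSpace ℝ (Fin 2))).map (fun b => ‖b‖ ^ 2) with hν
  have hIic : ∀ s, ν (Set.Iic s) = ENNReal.ofReal Real.pi * ENNReal.ofReal s := fun s => by
    rw [hν, Measure.map_apply (by fun_prop) measurableSet_Iic]
    rcases lt_or_ge s 0 with hs | hs
    · have hempty : (fun b : EuclideanSpace ℝ (Fin 2) => ‖b‖ ^ 2) ⁻¹' Set.Iic s = ∅ :=
        Set.eq_empty_of_forall_notMem fun b hb => (hs.trans_le (sq_nonneg ‖b‖)).not_ge hb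
      rw [hempty, measure_empty, ENNReal.ofReal_of_nonpos hs.le, mul_zero]
    · have hball : (fun b : EuclideanSpace ℝ (Fin 2) => ‖b‖ ^ 2) ⁻¹' Set.Iic s =
          Metric.closedBall 0 √s := by
        ext b
        simp [Real.le_sqrt (norm_nonneg b) hs]
      rw [hball, EuclideanSpace.volume_closedBall_fin_two, mul_comm,
        ← ENNReal.ofReal_pow (Real.sqrt_nonneg s), Real.sq_sqrt hs]
  have hIoc : ∀ a b, a ≤ b → ν (Set.Ioc a b) =
      ENNReal.ofReal Real.pi * (ENNReal.ofReal b - ENNReal.ofReal a) := fun a b hab => by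
    rw [← Set.Iic_sdiff_Iic, measure_sdiff (Set.Iic_subset_Iic.2 hab)
      measurableSet_Iic.nullMeasurableSet (by simp [hIic, ENNReal.mul_eq_top]), hIic, hIic,
      ENNReal.mul_sub fun _ _ => ENNReal.ofReal_ne_top]
  refine Measure.ext_of_Ioc' _ _ (fun a b hab => ?_) fun a b hab => ?_
  · rw [hIoc a b hab.le]
    exact ENNReal.mul_ne_top ENNReal.ofReal_ne_top (ENNReal.sub_ne_top ENNReal.ofReal_ne_top)
  · rw [hIoc a b hab.le, Measure.smul_apply, Measure.restrict_apply measurableSet_Ioc,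
      Set.Ioc_inter_Ioi, Real.volume_Ioc, ENNReal.ofReal_sub _ le_sup_right, smul_eq_mul,
      ENNReal.ofReal_max, ENNReal.ofReal_zero, max_eq_left zero_le]

end PushForward

section Coordinates

theorem exists_linearIsometryEquiv_apply_eq {E V : Type*} [NormedAddCommGroup E]
    [InnerProductSpace ℝ E] [FiniteDimensional ℝ E] [NormedAddCommGroup V]
    [InnerProductSpace ℝ V] [FiniteDimensional ℝ V]
    (h : Module.finrank ℝ E = Module.finrank ℝ V) {v : E} {w : V} (hvw : ‖v‖ = ‖w‖) :
    ∃ Φ : E ≃ₗᵢ[ℝ] V, Φ v = w := by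
  let Ψ : E ≃ₗᵢ[ℝ] V := (stdOrthonormalBasis ℝ E).equiv (stdOrthonormalBasis ℝ V) (finCongr h)
  exact ⟨Ψ.trans (Submodule.reflection (ℝ ∙ (Ψ v - w))ᗮ),
    Submodule.reflection_sub (by rw [Ψ.norm_map, hvw])⟩

end Coordinates

section Resonance

/-- The dispersion relation `⟨η⟩_m` as a function of the frequency. -/
def omega (m : ℝ) (η : Space) : ℝ := japanese m ‖η‖

theorem continuous_omega (m : ℝ) : Continuous (omega m) := by
  unfold omega japanese
  fun_prop

theorem omega_neg (m : ℝ) (η : Space) : omega m (-η) = omega m η := by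
  rw [omega, omega, norm_neg]

theorem sqrt_sq_add_le {m Λ x : ℝ} (hΛ : 0 ≤ Λ) (hx : x ≤ Λ ^ 2) : √(m ^ 2 + x) ≤ |m| + Λ :=
  Real.sqrt_le_iff.2 ⟨by positivity, by nlinarith [sq_abs m, abs_nonneg m]⟩

theorem map_sqrt_add_sqrt_le {S : Set ℝ} {u v : ℝ → ℝ} {N κ : ℝ} (hu : Measurable u)
    (hv : Measurable v) (hN0 : 0 ≤ N) (hκ : 0 < κ) (hu0 : ∀ a ∈ S, 0 ≤ u a)
    (huN : ∀ a ∈ S, √(u a) ≤ N) (huκ : ∀ a ∈ S, ∀ b ∈ S, a ≤ b → κ * (b - a) ≤ u b - u a)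
    (hvmono : MonotoneOn v S) :
    (volume.restrict S).map (fun a => √(u a) + √(v a)) ≤
      ENNReal.ofReal (2 * N / κ) • volume := by
  refine map_restrict_le_of_expanding (by fun_prop) fun a ha b hb => ?_
  rw [Real.coe_toNNReal _ (by positivity), div_mul_eq_mul_div, le_div_iff₀ hκ]
  wlog hab : a ≤ b generalizing a b
  · rw [abs_sub_comm, abs_sub_comm (√(u a) + √(v a))]
    exact this b hb a ha (le_of_not_ge hab)
  have huab : u a ≤ u b := by nlinarith [huκ a ha b hb hab]
  have hsu : √(u a) ≤ √(u b) := Real.sqrt_le_sqrt huab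
  have hsv : √(v a) ≤ √(v b) := Real.sqrt_le_sqrt (hvmono ha hb hab)
  rw [abs_sub_comm, abs_of_nonneg (sub_nonneg.2 hab), abs_sub_comm, abs_of_nonneg (by linarith)]
  calc (b - a) * κ ≤ √(u b) ^ 2 - √(u a) ^ 2 := by
        rw [Real.sq_sqrt (hu0 a ha), Real.sq_sqrt (hu0 b hb), mul_comm]
        exact huκ a ha b hb hab
    _ = (√(u b) + √(u a)) * (√(u b) - √(u a)) := by ring
    _ ≤ 2 * N * (√(u b) + √(v b) - (√(u a) + √(v a))) := by
        refine mul_le_mul ?_ ?_ (sub_nonneg.2 hsu) (by positivity)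
        · linarith [huN a ha, huN b hb]
        · linarith

theorem map_resonance_plane_le (m : ℝ) {Λ : ℝ} (hΛ : 0 ≤ Λ) (s y : ℝ) :
    (volume.restrict {b : EuclideanSpace ℝ (Fin 2) | s ^ 2 + ‖b‖ ^ 2 ≤ Λ ^ 2}).map
      (fun b => √(m ^ 2 + (s ^ 2 + ‖b‖ ^ 2)) + √(m ^ 2 + (y ^ 2 + ‖b‖ ^ 2))) ≤
      ENNReal.ofReal (Real.pi * (2 * (|m| + Λ))) • volume := by
  set Q := {q : ℝ | s ^ 2 + q ≤ Λ ^ 2}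
  have hQ : MeasurableSet Q := measurableSet_le (by fun_prop) (by fun_prop)
  have hn : Measurable fun b : EuclideanSpace ℝ (Fin 2) => ‖b‖ ^ 2 := by fun_prop
  set g : ℝ → ℝ := fun q => √(m ^ 2 + (s ^ 2 + q)) + √(m ^ 2 + (y ^ 2 + q))
  have hg : Measurable g := by fun_prop
  have hgQ : (volume.restrict (Q ∩ Set.Ioi 0)).map g ≤
      ENNReal.ofReal (2 * (|m| + Λ) / 1) • volume := by
    refine map_sqrt_add_sqrt_le (by fun_prop) (by fun_prop) (by positivity) one_pos ?_ ?_ ?_ ?_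
    · exact fun q hq => by have : 0 < q := hq.2; positivity
    · exact fun q hq => sqrt_sq_add_le hΛ hq.1
    · exact fun q _ r _ _ => by linarith
    · exact fun q _ r _ hqr => by gcongr
  calc (volume.restrict ((fun b => ‖b‖ ^ 2) ⁻¹' Q)).map (g ∘ fun b => ‖b‖ ^ 2)
      = ENNReal.ofReal Real.pi • (volume.restrict (Q ∩ Set.Ioi 0)).map g := by
        rw [← Measure.map_map hg hn, ← Measure.restrict_map hn hQ, map_norm_sq_plane,
          Measure.restrict_smul, Measure.restrict_restrict hQ, Measure.map_smul]
    _ ≤ ENNReal.ofReal Real.pi • ENNReal.ofReal (2 * (|m| + Λ) / 1) • volume := by gcongr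
    _ = ENNReal.ofReal (Real.pi * (2 * (|m| + Λ))) • volume := by
        rw [smul_smul, div_one, ENNReal.ofReal_mul Real.pi_nonneg]

theorem map_resonance_line_le (m : ℝ) {Λ α p : ℝ} (hΛ : 0 ≤ Λ) (hα : 0 < α) (hp : 0 ≤ p)
    (x q : ℝ) :
    (volume.restrict {s : ℝ | s ^ 2 + p ≤ Λ ^ 2 ∧ α ≤ s ∧ x ≤ s}).map
      (fun s => √(m ^ 2 + (s ^ 2 + p)) + √(m ^ 2 + ((x - s) ^ 2 + q))) ≤
      ENNReal.ofReal ((|m| + Λ) / α) • volume := by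
  rw [← mul_div_mul_left (|m| + Λ) α two_ne_zero]
  refine map_sqrt_add_sqrt_le (by fun_prop) (by fun_prop) (by positivity) (by positivity)
    ?_ ?_ ?_ ?_
  · exact fun s _ => by positivity
  · exact fun s hs => sqrt_sq_add_le hΛ hs.1
  · exact fun s ⟨_, hs, _⟩ t _ hst => by nlinarith
  · exact fun s ⟨_, _, hs⟩ t _ hst => by nlinarith

/-- Cartesian coordinates `(s, b)` of three-dimensional space, along an axis and in the plane
orthogonal to it. -/
abbrev AxialCoord : Type := WithLp 2 (ℝ × EuclideanSpace ℝ (Fin 2))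

theorem exists_axialCoord {s : ℝ} {w : Space} (h : |s| = ‖w‖) :
    ∃ Φ : AxialCoord ≃ₗᵢ[ℝ] Space, Φ (WithLp.toLp 2 (s, 0)) = w :=
  exists_linearIsometryEquiv_apply_eq
    (by simp [(WithLp.linearEquiv 2 ℝ (ℝ × EuclideanSpace ℝ (Fin 2))).finrank_eq]) (by simpa)

theorem measurePreserving_axialCoord (Φ : AxialCoord ≃ₗᵢ[ℝ] Space) :
    MeasurePreserving fun p => Φ (WithLp.toLp 2 p) :=
  Φ.measurePreserving.comp (WithLp.volume_preserving_toLp ℝ (EuclideanSpace ℝ (Fin 2)))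

theorem omega_apply (Φ : AxialCoord ≃ₗᵢ[ℝ] Space) (m : ℝ) (p : AxialCoord) :
    omega m (Φ p) = √(m ^ 2 + (p.fst ^ 2 + ‖p.snd‖ ^ 2)) := by
  rw [omega, japanese, Φ.norm_map, WithLp.prod_norm_sq_eq_of_L2, Real.norm_eq_abs, sq_abs]

theorem sq_add_sq_le_of_mem_closedBall {Φ : AxialCoord ≃ₗᵢ[ℝ] Space} {p : AxialCoord} {Λ : ℝ}
    (h : Φ p ∈ Metric.closedBall 0 Λ) : p.fst ^ 2 + ‖p.snd‖ ^ 2 ≤ Λ ^ 2 := by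
  rw [mem_closedBall_zero_iff, Φ.norm_map] at h
  rw [← sq_abs p.fst, ← Real.norm_eq_abs, ← WithLp.prod_norm_sq_eq_of_L2]
  gcongr

/-- In coordinates `(s, b)` with first axis along `ξ`, the resonance function is, for fixed `s`,
an increasing function of `|b| ^ 2`. -/
theorem map_resonance_ball_le (m : ℝ) {h Λ : ℝ} (hΛ : 0 ≤ Λ) (c ξ : Space) :
    (volume.restrict (Metric.closedBall c h ∩ Metric.closedBall 0 Λ)).map
      (fun η => omega m η + omega m (ξ - η)) ≤
      ENNReal.ofReal (Real.pi * (2 * (|m| + Λ)) * (2 * h)) • volume := by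
  obtain ⟨Φ, hΦ⟩ := exists_axialCoord (abs_norm ξ)
  obtain ⟨c, rfl⟩ := Φ.surjective c
  have hω := continuous_omega m
  rw [ENNReal.ofReal_mul (by positivity), ← Real.volume_closedBall c.fst h]
  refine map_restrict_le_of_fibers (measurePreserving_axialCoord Φ) (by fun_prop)
    (measurableSet_closedBall.inter measurableSet_closedBall) ?_ fun s => ?_
  · rintro s b ⟨hc, -⟩
    rw [Metric.mem_closedBall, Φ.dist_map, dist_eq_norm] at hc
    exact mem_closedBall_iff_norm.2 ((WithLp.norm_fst_le ℝ _).trans hc)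
  · have hresonance : ∀ b, omega m (Φ (WithLp.toLp 2 (s, b))) +
        omega m (ξ - Φ (WithLp.toLp 2 (s, b))) = √(m ^ 2 + (s ^ 2 + ‖b‖ ^ 2)) +
          √(m ^ 2 + ((‖ξ‖ - s) ^ 2 + ‖b‖ ^ 2)) := fun b => by
      conv_lhs => rw [← hΦ]
      simp [← map_sub, omega_apply]
    simp only [hresonance]
    refine (Measure.map_mono (Measure.restrict_mono ?_ le_rfl) (by fun_prop)).trans
      (map_resonance_plane_le m hΛ s (‖ξ‖ - s))
    exact fun b hb => sq_add_sq_le_of_mem_closedBall hb.2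

/-- In coordinates `(s, b)` with first axis along `e`, the resonance function is, for fixed `b`,
an increasing function of `s` wherever `η` and `ξ - η` lie on opposite sides of `eᗮ`. -/
theorem map_resonance_transversal_le (m : ℝ) {h Λ α : ℝ} (hh : 0 ≤ h) (hΛ : 0 ≤ Λ) (hα : 0 < α)
    {e : Space} (he : ‖e‖ = 1) (c ξ : Space) :
    (volume.restrict (Metric.closedBall c h ∩ Metric.closedBall 0 Λ ∩
      {η | max α (inner ℝ e ξ) ≤ inner ℝ e η})).map (fun η => omega m η + omega m (ξ - η)) ≤
      ENNReal.ofReal ((|m| + Λ) / α * (h ^ 2 * Real.pi)) • volume := by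
  obtain ⟨Φ, rfl⟩ := exists_axialCoord (abs_one.trans he.symm)
  obtain ⟨c, rfl⟩ := Φ.surjective c
  obtain ⟨ξ, rfl⟩ := Φ.surjective ξ
  have hω := continuous_omega m
  have harea : volume (Metric.closedBall c.snd h) = ENNReal.ofReal (h ^ 2 * Real.pi) := by
    rw [EuclideanSpace.volume_closedBall_fin_two, ENNReal.ofReal_mul (by positivity),
      ENNReal.ofReal_pow hh]
  have hinner : ∀ p : AxialCoord, inner ℝ (Φ (WithLp.toLp 2 (1, 0))) (Φ p) = p.fst := fun p => by
    simp [Φ.inner_map_map, WithLp.prod_inner_apply]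
  rw [ENNReal.ofReal_mul (by positivity), ← harea]
  refine map_restrict_le_of_fibers
    ((measurePreserving_axialCoord Φ).comp Measure.measurePreserving_swap) (by fun_prop)
    ((measurableSet_closedBall.inter measurableSet_closedBall).inter
      (measurableSet_le (by fun_prop) (by fun_prop))) ?_ fun b => ?_
  · rintro b s ⟨⟨hc, -⟩, -⟩
    change dist (Φ (WithLp.toLp 2 (s, b))) (Φ c) ≤ h at hc
    rw [Φ.dist_map, dist_eq_norm] at hc
    exact mem_closedBall_iff_norm.2 ((WithLp.norm_snd_le ℝ _).trans hc)
  · simp only [Function.comp_apply, Prod.swap_prod_mk, ← map_sub, omega_apply]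
    refine (Measure.map_mono (Measure.restrict_mono ?_ le_rfl) (by fun_prop)).trans
      (map_resonance_line_le m hΛ hα (sq_nonneg ‖b‖) ξ.fst (‖ξ.snd - b‖ ^ 2))
    rintro s ⟨⟨-, hs⟩, hes⟩
    simp only [Set.mem_ofPred_eq, hinner, max_le_iff] at hes
    exact ⟨sq_add_sq_le_of_mem_closedBall hs, hes⟩

end Resonance

/-! ### Decomposition into frequency cells -/

section AlmostOrthogonality

theorem evolve_indicator {X : Type*} (ω : X → ℝ) (t : ℝ) (S : Set X) (F : X → ℂ) :
    evolve ω t (S.indicator F) = S.indicator (evolve ω t F) := by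
  ext ξ
  by_cases hξ : ξ ∈ S <;> simp [evolve, hξ]

variable {V : Type*} [NormedAddCommGroup V] [InnerProductSpace ℝ V] [FiniteDimensional ℝ V]
  [MeasurableSpace V] [BorelSpace V] {F G : V → ℂ} {Λ Λ' : ℝ}

theorem sum_mul_sq_le_sq_mul_sq {ι : Type*} (s : Finset ι) (a b : ι → ℝ≥0∞) :
    (∑ k ∈ s, a k * b k) ^ 2 ≤ (∑ k ∈ s, a k ^ 2) * ∑ k ∈ s, b k ^ 2 := by
  have h := ENNReal.inner_le_Lp_mul_Lq s a b (p := 2) (q := 2)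
    (Real.holderConjugate_iff.2 ⟨one_lt_two, by norm_num⟩)
  refine (pow_le_pow_left' h 2).trans_eq ?_
  simp [mul_pow, ← ENNReal.rpow_mul_natCast]

theorem sum_eLpNorm_indicator_sq_le {X A E : Type*} [MeasurableSpace X] {μ : Measure X}
    [NormedAddCommGroup E] {κ : X → A} (hκ : ∀ a, MeasurableSet (κ ⁻¹' {a})) (s : Finset A)
    (F : X → E) :
    ∑ a ∈ s, eLpNorm ((κ ⁻¹' {a}).indicator F) 2 μ ^ 2 ≤ eLpNorm F 2 μ ^ 2 := by
  simp only [eLpNorm_indicator_eq_eLpNorm_restrict (hκ _), eLpNorm_two_sq]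
  rw [← lintegral_biUnion_finset _ fun a _ => hκ a]
  · exact setLIntegral_le_lintegral _ _
  · exact fun a _ b _ hab => (Set.disjoint_singleton.2 hab).preimage κ

variable {A : Type*} [AddCommGroup A] {κ : V → A}

theorem sum_eLpNorm_indicator_mul_le (hκ : ∀ a, MeasurableSet (κ ⁻¹' {a})) (s : Finset A) (n : A)
    (F G : V → ℂ) :
    ∑ k ∈ s, eLpNorm ((κ ⁻¹' {k}).indicator F) 2 volume *
      eLpNorm ((κ ⁻¹' {n - k}).indicator G) 2 volume ≤
        eLpNorm F 2 volume * eLpNorm G 2 volume := by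
  rw [← ENNReal.pow_le_pow_left_iff two_ne_zero, mul_pow]
  refine (sum_mul_sq_le_sq_mul_sq _ _ _).trans
    (mul_le_mul' (sum_eLpNorm_indicator_sq_le hκ s F) ?_)
  simpa using sum_eLpNorm_indicator_sq_le hκ (s.map (Equiv.subLeft n).toEmbedding) G

theorem convolution_eq_sum_indicator (hκ : ∀ a, MeasurableSet (κ ⁻¹' {a})) {N s : Finset A}
    {ξ : V} (hFG : Integrable fun η => F η * G (ξ - η)) (hs : ∀ η, F η ≠ 0 → κ η ∈ s)
    (hN : ∀ η, κ η + κ (ξ - η) ∈ N) :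
    (F ⋆[ContinuousLinearMap.mul ℂ ℂ] G) ξ = ∑ n ∈ N, ∑ k ∈ s,
      ((κ ⁻¹' {k}).indicator F ⋆[ContinuousLinearMap.mul ℂ ℂ] (κ ⁻¹' {n - k}).indicator G) ξ := by
  classical
  have hpiece : ∀ n k,
      (fun η => (κ ⁻¹' {k}).indicator F η * (κ ⁻¹' {n - k}).indicator G (ξ - η)) =
      (κ ⁻¹' {k} ∩ (ξ - ·) ⁻¹' (κ ⁻¹' {n - k})).indicator fun η => F η * G (ξ - η) := fun n k => by
    ext η
    rw [Set.inter_indicator_mul]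
    rfl
  have hint : ∀ n k, Integrable ((κ ⁻¹' {k} ∩ (ξ - ·) ⁻¹' (κ ⁻¹' {n - k})).indicator
      fun η => F η * G (ξ - η)) := fun n k =>
    hFG.indicator ((hκ k).inter (measurable_const_sub ξ (hκ (n - k))))
  simp only [convolution_mul, hpiece]
  simp_rw [← integral_finsetSum _ fun k _ => hint _ k]
  rw [← integral_finsetSum _ fun n _ => integrable_finsetSum _ fun k _ => hint n k]
  refine integral_congr_ae (ae_of_all _ fun η => ?_)
  by_cases hη : F η = 0
  · simp [hη, Set.indicator]
  · simp only [Set.indicator, Set.mem_inter_iff, Set.mem_preimage, Set.mem_singleton_iff,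
      eq_sub_iff_add_eq', ite_and]
    simp [hs η hη, hN η]

variable {ω : V → ℝ} {ε : ℝ}

theorem waveConv_eq_sum_indicator (hκ : ∀ a, MeasurableSet (κ ⁻¹' {a})) (hω : Measurable ω)
    (hF : IsBandlimited F Λ) (hG : IsBandlimited G Λ') {N s : Finset A} {p : ℝ × V}
    (hs : ∀ η, F η ≠ 0 → κ η ∈ s) (hN : ∀ η, κ η + κ (p.2 - η) ∈ N) :
    waveConv ω ε F G p = ∑ n ∈ N, ∑ k ∈ s,
      waveConv ω ε ((κ ⁻¹' {k}).indicator F) ((κ ⁻¹' {n - k}).indicator G) p := by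
  have hFt := (hF.evolve hω p.1).memLp
  have hGt := (hG.evolve hω (ε * p.1)).memLp.comp_measurePreserving
    (Measure.measurePreserving_sub_left volume p.2)
  simp only [waveConv, evolve_indicator]
  exact convolution_eq_sum_indicator hκ (hFt.integrable_mul hGt)
    (fun η h => hs η (right_ne_zero_of_mul h)) hN

/-- For an output frequency in `B` each piece of `F` interacts with boundedly many pieces of `G`,
so that the bound for the pieces sums up by Cauchy-Schwarz. -/
theorem eLpNorm_indicator_waveConv_le_of_pieces (hκ : ∀ a, MeasurableSet (κ ⁻¹' {a}))
    (hω : Measurable ω) (hF : IsBandlimited F Λ) (hG : IsBandlimited G Λ') {N s : Finset A}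
    {B : Set V} (hs : ∀ η, F η ≠ 0 → κ η ∈ s) (hN : ∀ ξ ∈ B, ∀ η, κ η + κ (ξ - η) ∈ N)
    {M : ℝ≥0∞}
    (hM : ∀ n ∈ N, ∀ k, eLpNorm
      (waveConv ω ε ((κ ⁻¹' {k}).indicator F) ((κ ⁻¹' {n - k}).indicator G)) 2 volume ≤
        M * (eLpNorm ((κ ⁻¹' {k}).indicator F) 2 volume *
          eLpNorm ((κ ⁻¹' {n - k}).indicator G) 2 volume)) :
    eLpNorm ((Prod.snd ⁻¹' B).indicator (waveConv ω ε F G)) 2 volume ≤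
      N.card * (M * (eLpNorm F 2 volume * eLpNorm G 2 volume)) := by
  set W : A → A → ℝ × V → ℂ := fun n k =>
    waveConv ω ε ((κ ⁻¹' {k}).indicator F) ((κ ⁻¹' {n - k}).indicator G)
  have hW : ∀ n k, AEStronglyMeasurable (W n k) volume := fun n k =>
    (stronglyMeasurable_waveConv hω ε (hF.indicator (hκ k)).stronglyMeasurable
      (hG.indicator (hκ (n - k))).stronglyMeasurable).aestronglyMeasurable
  have hpointwise : ∀ p, ‖(Prod.snd ⁻¹' B).indicator (waveConv ω ε F G) p‖ ≤
      ‖(∑ n ∈ N, ∑ k ∈ s, W n k) p‖ := fun p => by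
    by_cases hp : p ∈ Prod.snd ⁻¹' B
    · rw [Set.indicator_of_mem hp,
        waveConv_eq_sum_indicator hκ hω hF hG hs (hN p.2 hp)]
      simp [W]
    · simp [Set.indicator_of_notMem hp]
  calc eLpNorm ((Prod.snd ⁻¹' B).indicator (waveConv ω ε F G)) 2 volume
      ≤ eLpNorm (∑ n ∈ N, ∑ k ∈ s, W n k) 2 volume := eLpNorm_mono hpointwise
    _ ≤ ∑ n ∈ N, ∑ k ∈ s, eLpNorm (W n k) 2 volume :=
        (eLpNorm_sum_le (fun n _ => Finset.aestronglyMeasurable_sum _ fun k _ => hW n k)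
          one_le_two).trans
          (Finset.sum_le_sum fun n _ => eLpNorm_sum_le (fun k _ => hW n k) one_le_two)
    _ ≤ ∑ _ ∈ N, M * (eLpNorm F 2 volume * eLpNorm G 2 volume) := by
        refine Finset.sum_le_sum fun n hn => (Finset.sum_le_sum fun k _ => hM n hn k).trans ?_
        rw [← Finset.mul_sum]
        gcongr
        exact sum_eLpNorm_indicator_mul_le hκ s n F G
    _ = N.card * (M * (eLpNorm F 2 volume * eLpNorm G 2 volume)) := by
        rw [Finset.sum_const, nsmul_eq_mul]

end AlmostOrthogonality

section Cells

/-- The index of the cube of the grid of side `h` which contains `η`. -/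
def cell (h : ℝ) (η : Space) (i : Fin 3) : ℤ := ⌊η i / h⌋

variable {h : ℝ}

theorem measurableSet_cell (h : ℝ) (k : Fin 3 → ℤ) : MeasurableSet (cell h ⁻¹' {k}) := by
  have hcell : Measurable (cell h) :=
    measurable_pi_lambda _ fun i => Int.measurable_floor.comp (by fun_prop)
  exact hcell (measurableSet_singleton k)

theorem norm_le_two_mul_of_forall_abs_le {v : Space} {b : ℝ} (hv : ∀ i, |v i| ≤ b) :
    ‖v‖ ≤ 2 * b := by
  have hb : 0 ≤ b := (abs_nonneg _).trans (hv 0)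
  have hsq : ∀ i, v i ^ 2 ≤ b ^ 2 := fun i => sq_le_sq' (abs_le.1 (hv i)).1 (abs_le.1 (hv i)).2
  refine abs_le_of_sq_le_sq' ?_ (by positivity) |>.2
  simp only [EuclideanSpace.norm_sq_eq, Fin.sum_univ_three, Real.norm_eq_abs, sq_abs]
  linarith [hsq 0, hsq 1, hsq 2, sq_nonneg b]

theorem apply_mem_Ico_cell (hh : 0 < h) (η : Space) (i : Fin 3) :
    η i ∈ Set.Ico (cell h η i * h) ((cell h η i + 1) * h) :=
  ⟨(le_div_iff₀ hh).1 (Int.floor_le _), (div_lt_iff₀ hh).1 (Int.lt_floor_add_one _)⟩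

theorem norm_sub_le_of_cell_eq (hh : 0 < h) {η η' : Space} (hcell : cell h η = cell h η') :
    ‖η - η'‖ ≤ 2 * h := by
  refine norm_le_two_mul_of_forall_abs_le fun i => ?_
  have hη := apply_mem_Ico_cell hh η i
  have hη' := apply_mem_Ico_cell hh η' i
  rw [hcell] at hη
  rw [PiLp.sub_apply, abs_le]
  constructor <;> linarith [hη.1, hη.2, hη'.1, hη'.2]

/-- The possible sums of the cell indices of two frequencies whose sum is at most the side of the
cells, up to an overestimate. -/
def nearIndices : Finset (Fin 3 → ℤ) := Fintype.piFinset fun _ => Finset.Icc (-3) 3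

theorem card_nearIndices : nearIndices.card = 343 := by
  simp [nearIndices]

theorem norm_add_le_of_cell_add_mem (hh : 0 < h) {η ζ : Space}
    (hcell : cell h η + cell h ζ ∈ nearIndices) : ‖η + ζ‖ ≤ 10 * h := by
  rw [show 10 * h = 2 * (5 * h) by ring]
  refine norm_le_two_mul_of_forall_abs_le fun i => ?_
  have hη := apply_mem_Ico_cell hh η i
  have hζ := apply_mem_Ico_cell hh ζ i
  have hi := Finset.mem_Icc.1 (Fintype.mem_piFinset.1 hcell i)
  have hlow : (-3 : ℝ) ≤ cell h η i + cell h ζ i := by exact_mod_cast hi.1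
  have hupp : (cell h η i + cell h ζ i : ℝ) ≤ 3 := by exact_mod_cast hi.2
  rw [PiLp.add_apply, abs_le]
  constructor <;> nlinarith [hη.1, hη.2, hζ.1, hζ.2]

theorem cell_add_cell_mem_nearIndices (hh : 0 < h) {ξ : Space} (hξ : ‖ξ‖ ≤ h) (η : Space) :
    cell h η + cell h (ξ - η) ∈ nearIndices := by
  refine Fintype.mem_piFinset.2 fun i => Finset.mem_Icc.2 ?_
  have hη := apply_mem_Ico_cell hh η i
  have hζ := apply_mem_Ico_cell hh (ξ - η) i
  have hξi := abs_le.1 ((PiLp.norm_apply_le ξ i).trans hξ)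
  rw [PiLp.sub_apply] at hζ
  have hlow : (-3 : ℝ) ≤ cell h η i + cell h (ξ - η) i :=
    le_of_mul_le_mul_right (by linarith [hη.2, hζ.2, hξi.1]) hh
  have hupp : (cell h η i + cell h (ξ - η) i : ℝ) ≤ 3 :=
    le_of_mul_le_mul_right (by linarith [hη.1, hζ.1, hξi.2]) hh
  exact ⟨by exact_mod_cast hlow, by exact_mod_cast hupp⟩

theorem exists_finset_cell_mem (hh : 0 < h) (Λ : ℝ) :
    ∃ s : Finset (Fin 3 → ℤ), ∀ η : Space, ‖η‖ ≤ Λ → cell h η ∈ s := by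
  refine ⟨Fintype.piFinset fun _ => Finset.Icc ⌊-Λ / h⌋ ⌊Λ / h⌋, fun η hη =>
    Fintype.mem_piFinset.2 fun i => Finset.mem_Icc.2 ?_⟩
  have hηi := abs_le.1 ((PiLp.norm_apply_le η i).trans hη)
  exact ⟨Int.floor_le_floor (div_le_div_of_nonneg_right hηi.1 hh.le),
    Int.floor_le_floor (div_le_div_of_nonneg_right hηi.2 hh.le)⟩

theorem eLpNorm_indicator_waveConv_le_of_cells {ω : Space → ℝ} {F G : Space → ℂ} {Λ Λ' ε : ℝ}
    (hω : Measurable ω) (hF : IsBandlimited F Λ) (hG : IsBandlimited G Λ') (hh : 0 < h)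
    {M : ℝ≥0∞}
    (hM : ∀ n ∈ nearIndices, ∀ k, eLpNorm
      (waveConv ω ε ((cell h ⁻¹' {k}).indicator F) ((cell h ⁻¹' {n - k}).indicator G)) 2 volume ≤
        M * (eLpNorm ((cell h ⁻¹' {k}).indicator F) 2 volume *
          eLpNorm ((cell h ⁻¹' {n - k}).indicator G) 2 volume)) :
    eLpNorm ((Prod.snd ⁻¹' Metric.closedBall 0 h).indicator (waveConv ω ε F G)) 2 volume ≤
      343 * (M * (eLpNorm F 2 volume * eLpNorm G 2 volume)) := by
  obtain ⟨s, hs⟩ := exists_finset_cell_mem hh Λ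
  have hbound := eLpNorm_indicator_waveConv_le_of_pieces (B := Metric.closedBall 0 h)
    (measurableSet_cell h) hω hF hG (fun η hη => hs η (hF.norm_le η hη))
    (fun ξ hξ => cell_add_cell_mem_nearIndices hh (mem_closedBall_zero_iff.1 hξ)) hM
  simpa only [card_nearIndices, Nat.cast_ofNat] using hbound

end Cells

section Bilinear

variable {V : Type*} [NormedAddCommGroup V] [InnerProductSpace ℝ V] [FiniteDimensional ℝ V]
  [MeasurableSpace V] [BorelSpace V]

theorem IsBandlimited.exists_eLpNorm_waveConv_eq {ω : V → ℝ} {G : V → ℂ} {Λ' ε : ℝ}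
    (hG : IsBandlimited G Λ') (hω : Measurable ω) (hω_even : ∀ ξ, ω (-ξ) = ω ξ)
    (hε : ε = 1 ∨ ε = -1) :
    ∃ G', IsBandlimited G' Λ' ∧ eLpNorm G' 2 volume = eLpNorm G 2 volume ∧
      ∀ {F : V → ℂ} {Λ : ℝ}, IsBandlimited F Λ →
        eLpNorm (waveConv ω ε F G) 2 volume = eLpNorm (waveConv ω 1 F G') 2 volume := by
  rcases hε with rfl | rfl
  · exact ⟨G, hG, rfl, fun _ => rfl⟩
  · exact ⟨_, hG.reflect,
      eLpNorm_reflect hG.stronglyMeasurable.aestronglyMeasurable 2,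
      fun hF => eLpNorm_waveConv_neg_one hω hω_even hF hG⟩

variable {F G : Space → ℂ} {m Λ Λ' h M : ℝ}

theorem eLpNorm_waveConv_one_le_of_subset (hF : IsBandlimited F Λ) (hG : IsBandlimited G Λ')
    (hM : 0 ≤ M) {D : ℝ} (hD : D ≤ M ^ 2) {U : Space → Set Space}
    (hU : ∀ ξ η, F η ≠ 0 → G (ξ - η) ≠ 0 → η ∈ U ξ)
    (hmap : ∀ ξ, (volume.restrict (U ξ)).map (fun η => omega m η + omega m (ξ - η)) ≤
      ENNReal.ofReal D • volume) :
    eLpNorm (waveConv (omega m) 1 F G) 2 volume ≤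
      ENNReal.ofReal M * (eLpNorm F 2 volume * eLpNorm G 2 volume) := by
  have hω := (continuous_omega m).measurable
  refine eLpNorm_waveConv_one_le hω hF.stronglyMeasurable hG.stronglyMeasurable hF.memLp hG.memLp
    fun ξ => ?_
  have hphase : Measurable fun η => omega m η + omega m (ξ - η) := by fun_prop
  calc (volume.restrict {η | F η ≠ 0 ∧ G (ξ - η) ≠ 0}).map
        (fun η => omega m η + omega m (ξ - η))
      ≤ (volume.restrict (U ξ)).map fun η => omega m η + omega m (ξ - η) :=
        Measure.map_mono (Measure.restrict_mono (fun η hη => hU ξ η hη.1 hη.2) le_rfl) hphase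
    _ ≤ ENNReal.ofReal D • volume := hmap ξ
    _ ≤ ENNReal.ofReal M ^ 2 • volume := by
        rw [← ENNReal.ofReal_pow hM]
        gcongr

theorem eLpNorm_waveConv_one_le_of_ball (hΛ : 0 ≤ Λ) (hF : IsBandlimited F Λ)
    (hG : IsBandlimited G Λ') {c : Space} (hFc : ∀ η, F η ≠ 0 → ‖η - c‖ ≤ h) (hM : 0 ≤ M)
    (hM2 : 4 * Real.pi * (|m| + Λ) * h ≤ M ^ 2) :
    eLpNorm (waveConv (omega m) 1 F G) 2 volume ≤
      ENNReal.ofReal M * (eLpNorm F 2 volume * eLpNorm G 2 volume) :=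
  eLpNorm_waveConv_one_le_of_subset hF hG hM
    (by linarith) (U := fun _ => Metric.closedBall c h ∩ Metric.closedBall 0 Λ)
    (fun _ η hη _ => ⟨mem_closedBall_iff_norm.2 (hFc η hη),
      mem_closedBall_zero_iff.2 (hF.norm_le η hη)⟩)
    (map_resonance_ball_le m hΛ c)

theorem eLpNorm_waveConv_le_of_ball {ε : ℝ} (hε : ε = 1 ∨ ε = -1) (hΛ : 0 ≤ Λ)
    (hF : IsBandlimited F Λ) (hG : IsBandlimited G Λ') {c : Space}
    (hFc : ∀ η, F η ≠ 0 → ‖η - c‖ ≤ h) (hM : 0 ≤ M)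
    (hM2 : 4 * Real.pi * (|m| + Λ) * h ≤ M ^ 2) :
    eLpNorm (waveConv (omega m) ε F G) 2 volume ≤
      ENNReal.ofReal M * (eLpNorm F 2 volume * eLpNorm G 2 volume) := by
  obtain ⟨G', hG', hnorm, heq⟩ :=
    hG.exists_eLpNorm_waveConv_eq (continuous_omega m).measurable (omega_neg m) hε
  rw [heq hF, ← hnorm]
  exact eLpNorm_waveConv_one_le_of_ball hΛ hF hG' hFc hM hM2

theorem eLpNorm_waveConv_le_left {ε : ℝ} (hε : ε = 1 ∨ ε = -1) (hΛ : 0 ≤ Λ)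
    (hF : IsBandlimited F Λ) (hG : IsBandlimited G Λ') (hM : 0 ≤ M)
    (hM2 : 4 * Real.pi * (|m| + Λ) * Λ ≤ M ^ 2) :
    eLpNorm (waveConv (omega m) ε F G) 2 volume ≤
      ENNReal.ofReal M * (eLpNorm F 2 volume * eLpNorm G 2 volume) :=
  eLpNorm_waveConv_le_of_ball (c := 0) hε hΛ hF hG
    (fun η hη => (sub_zero η).symm ▸ hF.norm_le η hη) hM hM2

theorem eLpNorm_waveConv_le_right {ε : ℝ} (hε : ε = 1 ∨ ε = -1) (hΛ' : 0 ≤ Λ')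
    (hF : IsBandlimited F Λ) (hG : IsBandlimited G Λ') (hM : 0 ≤ M)
    (hM2 : 4 * Real.pi * (|m| + Λ') * Λ' ≤ M ^ 2) :
    eLpNorm (waveConv (omega m) ε F G) 2 volume ≤
      ENNReal.ofReal M * (eLpNorm F 2 volume * eLpNorm G 2 volume) := by
  obtain ⟨G', hG', hnorm, heq⟩ :=
    hG.exists_eLpNorm_waveConv_eq (continuous_omega m).measurable (omega_neg m) hε
  rw [heq hF, ← hnorm, waveConv_one_comm, mul_comm (eLpNorm F 2 volume)]
  exact eLpNorm_waveConv_le_left (Or.inl rfl) hΛ' hG' hF hM hM2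

/-- The supports of `F` and `G` lie in nearly opposite balls far from the origin, where the
gradients of `ω` at `η` and at `ξ - η` are nearly opposite, so that their difference, which is the
gradient of the resonance function, is bounded below. -/
theorem eLpNorm_waveConv_one_le_of_transversal (hΛ : 0 ≤ Λ) (hF : IsBandlimited F Λ)
    (hG : IsBandlimited G Λ') (hh : 0 < h) {c : Space} (hc : 5 * h ≤ ‖c‖)
    (hFc : ∀ η, F η ≠ 0 → ‖η - c‖ ≤ h) (hGc : ∀ ζ, G ζ ≠ 0 → ‖ζ + c‖ ≤ 5 * h)
    (hM : 0 ≤ M) (hM2 : (|m| + Λ) / (‖c‖ / 2) * (h ^ 2 * Real.pi) ≤ M ^ 2) :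
    eLpNorm (waveConv (omega m) 1 F G) 2 volume ≤
      ENNReal.ofReal M * (eLpNorm F 2 volume * eLpNorm G 2 volume) := by
  have hc0 : 0 < ‖c‖ := lt_of_lt_of_le (by positivity) hc
  set e : Space := ‖c‖⁻¹ • c
  have he : ‖e‖ = 1 := norm_smul_inv_norm (𝕜 := ℝ) (norm_pos_iff.1 hc0)
  have hec : inner ℝ e c = ‖c‖ := by
    rw [real_inner_smul_left, real_inner_self_eq_norm_sq, sq, inv_mul_cancel_left₀ hc0.ne']
  have hinner (v : Space) : |inner ℝ e v| ≤ ‖v‖ := by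
    simpa [he] using abs_real_inner_le_norm e v
  refine eLpNorm_waveConv_one_le_of_subset hF hG hM hM2 (fun ξ η hη hζ => ?_)
    (map_resonance_transversal_le m hh.le hΛ (half_pos hc0) he c)
  refine ⟨⟨mem_closedBall_iff_norm.2 (hFc η hη), mem_closedBall_zero_iff.2 (hF.norm_le η hη)⟩,
    Set.mem_ofPred_eq ▸ max_le ?_ ?_⟩
  · have hηc := abs_le.1 ((hinner (η - c)).trans (hFc η hη))
    rw [inner_sub_right, hec] at hηc
    linarith
  · have hζc := abs_le.1 ((hinner (ξ - η + c)).trans (hGc _ hζ))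
    rw [inner_add_right, inner_sub_right, hec] at hζc
    linarith

end Bilinear

/-! ### Frequency-localized Klein-Gordon waves -/

section Symbols

theorem Cutoff.eq_zero_of_two_le_abs (χ : Cutoff) {s : ℝ} (hs : 2 ≤ |s|) : χ.toFun s = 0 := by
  by_contra h
  exact hs.not_gt (abs_lt.2 (χ.tsupport_subset (subset_tsupport _ h)))

theorem Cutoff.abs_lt_of_rho_ne_zero (χ : Cutoff) {lam s : ℝ} (hlam : 1 ≤ lam)
    (h : χ.rho lam s ≠ 0) : |s| < 2 * lam := by
  have hpos : 0 < lam := by linarith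
  contrapose! h
  unfold Cutoff.rho
  split_ifs with hlt heq
  · rfl
  · exact χ.eq_zero_of_two_le_abs (by linarith)
  · rw [χ.eq_zero_of_two_le_abs (s := s / lam), χ.eq_zero_of_two_le_abs (s := 2 * s / lam),
      sub_zero]
    · rw [abs_div, abs_of_pos hpos, abs_mul, le_div_iff₀ hpos, abs_two]
      linarith
    · rwa [abs_div, abs_of_pos hpos, le_div_iff₀ hpos]

theorem Cutoff.lt_abs_of_rho_ne_zero (χ : Cutoff) {lam s : ℝ} (hlam : 1 < lam)
    (h : χ.rho lam s ≠ 0) : lam / 2 < |s| := by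
  have hpos : 0 < lam := by linarith
  contrapose! h
  rw [Cutoff.rho, if_neg hlam.not_gt, if_neg hlam.ne', χ.eq_one, χ.eq_one, sub_self]
  · rw [abs_div, abs_of_pos hpos, abs_mul, div_le_one hpos, abs_two]
    linarith
  · rw [abs_div, abs_of_pos hpos, div_le_one hpos]
    linarith

theorem Cutoff.exists_abs_rho_le (χ : Cutoff) : ∃ B, 0 < B ∧ ∀ lam s, |χ.rho lam s| ≤ B := by
  obtain ⟨C, hC⟩ := χ.hasCompactSupport.exists_bound_of_continuous χ.contDiff.continuous
  have hC1 : 1 ≤ C := by simpa [χ.eq_one 0 (by simp)] using hC 0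
  refine ⟨C + C, by linarith, fun lam s => ?_⟩
  unfold Cutoff.rho
  split_ifs
  · rw [abs_zero]
    linarith
  · exact (hC s).trans (by linarith)
  · exact (abs_sub _ _).trans (add_le_add (hC _) (hC _))

variable {χ : Cutoff} {lam : ℝ} {ξ : Space}

theorem norm_le_of_projSymbol_ne_zero (hlam : 1 ≤ lam) (h : projSymbol χ lam ξ ≠ 0) :
    ‖ξ‖ ≤ lam / Real.pi := by
  have hξ := χ.abs_lt_of_rho_ne_zero hlam (Complex.ofReal_ne_zero.1 h)
  rw [abs_of_nonneg (by positivity)] at hξ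
  rw [le_div_iff₀ Real.pi_pos]
  linarith

theorem le_norm_of_projSymbol_ne_zero (hlam : 1 < lam) (h : projSymbol χ lam ξ ≠ 0) :
    lam / (4 * Real.pi) ≤ ‖ξ‖ := by
  have hξ := χ.lt_abs_of_rho_ne_zero hlam (Complex.ofReal_ne_zero.1 h)
  rw [abs_of_nonneg (by positivity)] at hξ
  rw [div_le_iff₀ (by positivity)]
  linarith

theorem continuous_projSymbol (χ : Cutoff) (lam : ℝ) : Continuous (projSymbol χ lam) := by
  have hrho := χ.continuous_rho lam
  unfold projSymbol
  fun_prop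

theorem waveSymbol_eq (m t : ℝ) (ξ : Space) :
    waveSymbol m t ξ = Real.fourierChar (-(t * omega (m / (2 * Real.pi)) ξ)) := by
  have hscale : japanese m (2 * Real.pi * ‖ξ‖) =
      2 * Real.pi * omega (m / (2 * Real.pi)) ξ := by
    unfold omega japanese
    rw [← Real.sqrt_sq Real.two_pi_pos.le, ← Real.sqrt_mul (by positivity),
      Real.sqrt_sq Real.two_pi_pos.le]
    congr 1
    field_simp
  rw [waveSymbol, Real.fourierChar_apply, hscale]
  congr 2
  push_cast
  ring

end Symbols

section Profile

/-- The function `F` represents the Fourier transform of `f`, has frequencies at most `Λ`, and its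
free evolution gives the free wave `S_m(t) f`. The mass becomes `m / 2π` because of the kernel
`exp (-2πi ⟨x, ξ⟩)`. -/
structure IsProfile (m : ℝ) (f : L2) (F : Space → ℂ) (Λ : ℝ) : Prop extends
    IsBandlimited F Λ where
  eLpNorm_eq : eLpNorm F 2 volume = ENNReal.ofReal ‖f‖
  propagator_ae_eq : ∀ t,
    propagator m t f =ᵐ[volume] 𝓕⁻ (evolve (omega (m / (2 * Real.pi))) t F)

theorem multiplier_ae_eq {a : Space → ℂ} (ha : MemLp a ∞ volume) (f : L2) :
    (𝓕 (multiplier a ha f) : L2) =ᵐ[volume] fun ξ => a ξ * (𝓕 f : L2) ξ := by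
  rw [multiplier, FourierTransform.fourier_fourierInv_eq (F := L2)]
  filter_upwards [Lp.coeFn_lpSMul (r := 2) (ha.toLp a) (𝓕 f : L2), ha.coeFn_toLp] with ξ hsmul hξ
  rw [hsmul, Pi.smul_apply', hξ, smul_eq_mul]

theorem IsBandlimited.isProfile {f : L2} {F : Space → ℂ} {Λ : ℝ} (hF : IsBandlimited F Λ)
    (m : ℝ) (hfF : (𝓕 f : L2) =ᵐ[volume] F) : IsProfile m f F Λ where
  toIsBandlimited := hF
  eLpNorm_eq := by
    rw [← eLpNorm_congr_ae hfF, ← Lp.enorm_def, ← ofReal_norm, Lp.norm_fourier_eq]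
  propagator_ae_eq t := by
    have hFt := hF.evolve (continuous_omega (m / (2 * Real.pi))).measurable t
    have hfourier : (𝓕 (propagator m t f) : L2) = hFt.memLp.toLp := by
      refine Lp.ext ?_
      filter_upwards [multiplier_ae_eq (memLp_waveSymbol m t) f, hFt.memLp.coeFn_toLp, hfF]
        with ξ hmul hcoe hξ
      rw [propagator, hmul, hcoe, hξ, waveSymbol_eq, KleinGordon.evolve]
    rw [← FourierTransform.fourierInv_fourier_eq (F := L2) (propagator m t f), hfourier]
    exact fourierInv_toLp_ae_eq hFt.integrable hFt.memLp

theorem exists_isProfile_proj (χ : Cutoff) (m : ℝ) {lam : ℝ} (hlam : 1 ≤ lam) (f : L2) :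
    ∃ F : Space → ℂ, IsProfile m (proj χ lam f) F (lam / Real.pi) ∧
      (1 < lam → ∀ η, F η ≠ 0 → lam / (4 * Real.pi) ≤ ‖η‖) := by
  set S : Set Space := {ξ | projSymbol χ lam ξ ≠ 0}
  have hS : MeasurableSet S :=
    (continuous_projSymbol χ lam).measurable (measurableSet_singleton 0).compl
  set P : L2 := 𝓕 (proj χ lam f)
  have hPS : P =ᵐ[volume] S.indicator P := by
    filter_upwards [multiplier_ae_eq (memLp_projSymbol χ lam) f] with ξ hξ
    by_cases hmem : ξ ∈ S
    · rw [Set.indicator_of_mem hmem]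
    · rw [Set.indicator_of_notMem hmem]
      exact hξ.trans (by rw [not_not.1 hmem, zero_mul])
  have hband : IsBandlimited (S.indicator P) (lam / Real.pi) :=
    { stronglyMeasurable := (Lp.stronglyMeasurable P).indicator hS
      memLp := (Lp.memLp P).indicator hS
      norm_le := fun η h =>
        norm_le_of_projSymbol_ne_zero hlam (Set.indicator_apply_ne_zero.1 h).1 }
  exact ⟨S.indicator P, hband.isProfile m hPS, fun hlt η h =>
    le_norm_of_projSymbol_ne_zero hlt (Set.indicator_apply_ne_zero.1 h).1⟩

end Profile

section Interaction

variable {χ : Cutoff} {m mu ε : ℝ} {f g : L2} {F G : Space → ℂ} {Λ Λ' : ℝ}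

theorem interaction_eq (hF : IsProfile m f F Λ) (hG : IsProfile m g G Λ') (p : ℝ × Space) :
    interaction χ m mu ε f g p = 𝓕⁻ (fun ξ =>
      projSymbol χ mu ξ * waveConv (omega (m / (2 * Real.pi))) ε F G (p.1, ξ)) p.2 := by
  have hω := (continuous_omega (m / (2 * Real.pi))).measurable
  have hFt := hF.evolve hω p.1
  have hGt := hG.evolve hω (ε * p.1)
  have hprod : (fun x => propagator m p.1 f x * propagator m (ε * p.1) g x) =ᵐ[volume]
      𝓕⁻ (evolve (omega (m / (2 * Real.pi))) p.1 F) *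
        𝓕⁻ (evolve (omega (m / (2 * Real.pi))) (ε * p.1) G) :=
    (hF.propagator_ae_eq p.1).mul (hG.propagator_ae_eq (ε * p.1))
  refine Real.fourierInv_congr_ae ?_ p.2
  filter_upwards [fourier_fourierInv_mul_ae_eq hFt.integrable hFt.memLp hGt.integrable hGt.memLp]
    with ξ hξ
  rw [Real.fourier_congr_ae hprod, hξ]
  rfl

theorem stronglyMeasurable_projSymbol_mul_waveConv {ω : Space → ℝ} (hω : Measurable ω)
    (hF : StronglyMeasurable F) (hG : StronglyMeasurable G) :
    StronglyMeasurable fun p : ℝ × Space => projSymbol χ mu p.2 * waveConv ω ε F G p :=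
  ((continuous_projSymbol χ mu).comp continuous_snd).stronglyMeasurable.mul
    (stronglyMeasurable_waveConv hω ε hF hG)

theorem stronglyMeasurable_interaction (hF : IsProfile m f F Λ) (hG : IsProfile m g G Λ') :
    StronglyMeasurable (interaction χ m mu ε f g) := by
  have hsymbol := (stronglyMeasurable_projSymbol_mul_waveConv (χ := χ) (mu := mu) (ε := ε)
    (continuous_omega (m / (2 * Real.pi))).measurable hF.stronglyMeasurable
    hG.stronglyMeasurable).comp_measurable
      (g := fun q : (ℝ × Space) × Space => (q.1.1, q.2)) (by fun_prop)
  have hchar : Continuous fun q : (ℝ × Space) × Space =>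
    (Real.fourierChar (inner ℝ q.2 q.1.2) : ℂ) := by fun_prop
  simp only [funext (interaction_eq hF hG), Real.fourierInv_eq]
  exact (hchar.stronglyMeasurable.mul hsymbol).integral_prod_right'

theorem eLpNorm_interaction_apply (hF : IsProfile m f F Λ) (hG : IsProfile m g G Λ') (t : ℝ) :
    eLpNorm (fun x => interaction χ m mu ε f g (t, x)) 2 volume =
      eLpNorm (fun ξ =>
        projSymbol χ mu ξ * waveConv (omega (m / (2 * Real.pi))) ε F G (t, ξ)) 2 volume := by
  have hω := (continuous_omega (m / (2 * Real.pi))).measurable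
  have hFt := hF.evolve hω t
  have hGt := hG.evolve hω (ε * t)
  simp only [interaction_eq hF hG]
  refine eLpNorm_fourierInv_eq ?_ ?_
  · exact memLp_one_iff_integrable.1 ((memLp_one_iff_integrable.2
      (hFt.integrable.integrable_convolution _ hGt.integrable)).mul (memLp_projSymbol χ mu))
  · exact (memLp_convolution hFt.integrable hFt.memLp hGt.integrable hGt.memLp).mul
      (memLp_projSymbol χ mu)

theorem eLpNorm_interaction_le {B : ℝ} (hB : ∀ s, |χ.rho mu s| ≤ B) (hmu : 1 ≤ mu)
    (hF : IsProfile m f F Λ) (hG : IsProfile m g G Λ') :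
    eLpNorm (interaction χ m mu ε f g) 2 volume ≤ ENNReal.ofReal B *
      eLpNorm ((Prod.snd ⁻¹' Metric.closedBall 0 mu).indicator
        (waveConv (omega (m / (2 * Real.pi))) ε F G)) 2 volume := by
  have hsymbol := stronglyMeasurable_projSymbol_mul_waveConv (χ := χ) (mu := mu) (ε := ε)
    (continuous_omega (m / (2 * Real.pi))).measurable hF.stronglyMeasurable hG.stronglyMeasurable
  refine (eLpNorm_two_prod_le (stronglyMeasurable_interaction hF hG).aestronglyMeasurable
    hsymbol.aestronglyMeasurable fun t => (eLpNorm_interaction_apply hF hG t).le).trans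
    (eLpNorm_le_mul_eLpNorm_of_ae_le_mul (ae_of_all _ fun p => ?_) 2)
  by_cases hp : p ∈ Prod.snd ⁻¹' Metric.closedBall (0 : Space) mu
  · rw [Set.indicator_of_mem hp, norm_mul]
    gcongr
    exact (Complex.norm_real _).trans_le (hB _)
  · have hzero : projSymbol χ mu p.2 = 0 := by
      by_contra h
      refine hp (mem_closedBall_zero_iff.2 ((norm_le_of_projSymbol_ne_zero hmu h).trans ?_))
      exact div_le_self (by linarith) (by linarith [Real.pi_gt_three])
    simp [Set.indicator_of_notMem hp, hzero]

theorem l2NormLe_interaction {B N : ℝ} (hB : ∀ s, |χ.rho mu s| ≤ B) (hmu : 1 ≤ mu)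
    (hF : IsProfile m f F Λ) (hG : IsProfile m g G Λ')
    (hN : eLpNorm ((Prod.snd ⁻¹' Metric.closedBall 0 mu).indicator
      (waveConv (omega (m / (2 * Real.pi))) ε F G)) 2 volume ≤
        ENNReal.ofReal N * (eLpNorm F 2 volume * eLpNorm G 2 volume)) :
    L2NormLe (interaction χ m mu ε f g) (B * N * ‖f‖ * ‖g‖) := by
  have hB0 : 0 ≤ B := (abs_nonneg _).trans (hB 0)
  have hbound : eLpNorm (interaction χ m mu ε f g) 2 volume ≤
      ENNReal.ofReal (B * N * ‖f‖ * ‖g‖) := by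
    refine (eLpNorm_interaction_le hB hmu hF hG).trans ((mul_le_mul_right hN _).trans_eq ?_)
    rw [hF.eLpNorm_eq, hG.eLpNorm_eq, ENNReal.ofReal_mul' (norm_nonneg _),
      ENNReal.ofReal_mul' (norm_nonneg _), ENNReal.ofReal_mul hB0, mul_assoc, mul_assoc]
  exact ⟨⟨(stronglyMeasurable_interaction hF hG).aestronglyMeasurable,
    hbound.trans_lt ENNReal.ofReal_lt_top⟩, hbound⟩

theorem L2NormLe.mono {u : ℝ × Space → ℂ} {b c : ℝ} (hu : L2NormLe u b) (hbc : b ≤ c) :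
    L2NormLe u c :=
  ⟨hu.1, hu.2.trans (ENNReal.ofReal_le_ofReal hbc)⟩

end Interaction

/-! ### Estimates at dyadic frequencies -/

section Estimates

variable {F G : Space → ℂ} {m mu lam lam₁ lam₂ Λ Λ' ε : ℝ}

theorem abs_add_div_pi_le (m : ℝ) (hlam : 1 ≤ lam) :
    |m| + lam / Real.pi ≤ (|m| + 1) * lam := by
  have hdiv : lam / Real.pi ≤ lam := div_le_self (by linarith) (by linarith [Real.pi_gt_three])
  nlinarith [abs_nonneg m]

theorem eLpNorm_waveConv_le_min (hε : ε = 1 ∨ ε = -1) (h₁ : 1 ≤ lam₁) (h₂ : 1 ≤ lam₂)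
    (hF : IsBandlimited F (lam₁ / Real.pi)) (hG : IsBandlimited G (lam₂ / Real.pi)) :
    eLpNorm (waveConv (omega m) ε F G) 2 volume ≤
      ENNReal.ofReal (2 * (|m| + 1) * min lam₁ lam₂) *
        (eLpNorm F 2 volume * eLpNorm G 2 volume) := by
  have hsq {lam : ℝ} (hlam : 1 ≤ lam) :
      4 * Real.pi * (|m| + lam / Real.pi) * (lam / Real.pi) ≤ (2 * (|m| + 1) * lam) ^ 2 :=
    calc 4 * Real.pi * (|m| + lam / Real.pi) * (lam / Real.pi)
        = 4 * (|m| + lam / Real.pi) * lam := by field_simp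
      _ ≤ 4 * ((|m| + 1) * lam) * lam := by
          gcongr
          exact abs_add_div_pi_le m hlam
      _ ≤ (|m| + 1) * (4 * ((|m| + 1) * lam) * lam) :=
          le_mul_of_one_le_left (by positivity) (by linarith [abs_nonneg m])
      _ = (2 * (|m| + 1) * lam) ^ 2 := by ring
  rcases min_choice lam₁ lam₂ with h | h <;> rw [h]
  · exact eLpNorm_waveConv_le_left hε (by positivity) hF hG (by positivity) (hsq h₁)
  · exact eLpNorm_waveConv_le_right hε (by positivity) hF hG (by positivity) (hsq h₂)

/-- It suffices to bound the interaction of pieces whose frequencies lie in balls of radius `2h`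
and `10h` with nearly opposite centres. -/
theorem eLpNorm_indicator_waveConv_le_of_balls {ω : Space → ℝ} {h M : ℝ} (hω : Measurable ω)
    (hF : IsBandlimited F Λ) (hG : IsBandlimited G Λ') (hh : 0 < h)
    (hM : ∀ S T : Set Space, MeasurableSet S → MeasurableSet T → ∀ c, F c ≠ 0 →
      (∀ η ∈ S, ‖η - c‖ ≤ 2 * h) → (∀ ζ ∈ T, ‖ζ + c‖ ≤ 10 * h) →
      eLpNorm (waveConv ω ε (S.indicator F) (T.indicator G)) 2 volume ≤
        ENNReal.ofReal M *
          (eLpNorm (S.indicator F) 2 volume * eLpNorm (T.indicator G) 2 volume)) :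
    eLpNorm ((Prod.snd ⁻¹' Metric.closedBall 0 h).indicator (waveConv ω ε F G)) 2 volume ≤
      ENNReal.ofReal (343 * M) * (eLpNorm F 2 volume * eLpNorm G 2 volume) := by
  rw [ENNReal.ofReal_mul (by norm_num), ENNReal.ofReal_ofNat, mul_assoc]
  refine eLpNorm_indicator_waveConv_le_of_cells hω hF hG hh fun n hn k => ?_
  by_cases hne : ∃ c, F c ≠ 0 ∧ cell h c = k
  · obtain ⟨c, hc, rfl⟩ := hne
    refine hM _ _ (measurableSet_cell h _) (measurableSet_cell h _) c hc
      (fun η hη => norm_sub_le_of_cell_eq hh hη)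
      (fun ζ hζ => norm_add_le_of_cell_add_mem hh ?_)
    rwa [show cell h ζ = n - cell h c from hζ, sub_add_cancel]
  · have hzero : (cell h ⁻¹' {k}).indicator F = 0 := by
      push Not at hne
      exact Set.indicator_eq_zero'.2
        (Set.disjoint_left.2 fun η hη hk => hne η hη hk)
    have hconv : waveConv ω ε 0 ((cell h ⁻¹' {n - k}).indicator G) = 0 := by
      ext p
      simp [waveConv, evolve, convolution_def]
    simp [hzero, hconv]

theorem eLpNorm_indicator_waveConv_le_sqrt (hε : ε = 1 ∨ ε = -1) (hmu : 1 ≤ mu) (hlam : 1 ≤ lam)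
    (hF : IsBandlimited F (lam / Real.pi)) (hG : IsBandlimited G Λ') :
    eLpNorm ((Prod.snd ⁻¹' Metric.closedBall 0 mu).indicator (waveConv (omega m) ε F G)) 2
        volume ≤
      ENNReal.ofReal (343 * (6 * (|m| + 1) * (√mu * √lam))) *
        (eLpNorm F 2 volume * eLpNorm G 2 volume) := by
  refine eLpNorm_indicator_waveConv_le_of_balls (continuous_omega m).measurable hF hG
    (by linarith) fun S T hS hT c _ hSc _ => ?_
  refine eLpNorm_waveConv_le_of_ball hε (by positivity) (hF.indicator hS) (hG.indicator hT)
    (fun η hη => hSc η (Set.indicator_apply_ne_zero.1 hη).1) (by positivity) ?_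
  calc 4 * Real.pi * (|m| + lam / Real.pi) * (2 * mu)
      ≤ 4 * 4 * ((|m| + 1) * lam) * (2 * mu) := by
        gcongr
        · exact Real.pi_le_four
        · exact abs_add_div_pi_le m hlam
    _ ≤ (|m| + 1) * (36 * ((|m| + 1) * (mu * lam))) := by
        have hq : 1 ≤ |m| + 1 := by linarith [abs_nonneg m]
        have hpos : 0 ≤ (|m| + 1) * (mu * lam) := by positivity
        nlinarith
    _ = (6 * (|m| + 1) * (√mu * √lam)) ^ 2 := by
        rw [mul_pow _ (√mu * √lam), mul_pow √mu, Real.sq_sqrt (by linarith),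
          Real.sq_sqrt (by linarith)]
        ring

theorem eLpNorm_indicator_waveConv_one_le_output_of_le (hmu : 1 ≤ mu)
    (hlam : 40 * Real.pi * mu ≤ lam) (hF : IsBandlimited F (lam / Real.pi))
    (hFlow : ∀ η, F η ≠ 0 → lam / (4 * Real.pi) ≤ ‖η‖) (hG : IsBandlimited G Λ') :
    eLpNorm ((Prod.snd ⁻¹' Metric.closedBall 0 mu).indicator (waveConv (omega m) 1 F G)) 2
        volume ≤
      ENNReal.ofReal (343 * (18 * (|m| + 1) * mu)) *
        (eLpNorm F 2 volume * eLpNorm G 2 volume) := by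
  have hlam1 : 1 ≤ lam := by nlinarith [Real.pi_gt_three]
  refine eLpNorm_indicator_waveConv_le_of_balls (continuous_omega m).measurable hF hG
    (by linarith) fun S T hS hT c hc hSc hTc => ?_
  have hclam := hFlow c hc
  have hcmu : 10 * mu ≤ ‖c‖ := by
    refine le_trans ?_ hclam
    rw [le_div_iff₀ (by positivity)]
    linarith
  refine eLpNorm_waveConv_one_le_of_transversal (h := 2 * mu) (by positivity) (hF.indicator hS)
    (hG.indicator hT) (by linarith) (by linarith)
    (fun η hη => hSc η (Set.indicator_apply_ne_zero.1 hη).1)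
    (fun ζ hζ => (hTc ζ (Set.indicator_apply_ne_zero.1 hζ).1).trans (by linarith))
    (by positivity) ?_
  calc (|m| + lam / Real.pi) / (‖c‖ / 2) * ((2 * mu) ^ 2 * Real.pi)
      ≤ (|m| + 1) * lam / (lam / (4 * Real.pi) / 2) * ((2 * mu) ^ 2 * Real.pi) := by
        gcongr
        exact abs_add_div_pi_le m hlam1
    _ = 32 * Real.pi ^ 2 * ((|m| + 1) * mu ^ 2) := by
        field_simp
        ring
    _ ≤ 324 * ((|m| + 1) * mu ^ 2) := by
        gcongr
        nlinarith [Real.pi_lt_d2, Real.pi_pos]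
    _ ≤ (|m| + 1) * (324 * ((|m| + 1) * mu ^ 2)) :=
        le_mul_of_one_le_left (by positivity) (by linarith [abs_nonneg m])
    _ = (18 * (|m| + 1) * mu) ^ 2 := by ring

theorem eLpNorm_indicator_waveConv_one_le_output (hmu : 1 ≤ mu) (h₁ : 1 ≤ lam₁) (h₂ : 1 ≤ lam₂)
    (hF : IsBandlimited F (lam₁ / Real.pi))
    (hFlow : 1 < lam₁ → ∀ η, F η ≠ 0 → lam₁ / (4 * Real.pi) ≤ ‖η‖)
    (hG : IsBandlimited G (lam₂ / Real.pi)) :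
    eLpNorm ((Prod.snd ⁻¹' Metric.closedBall 0 mu).indicator (waveConv (omega m) 1 F G)) 2
        volume ≤
      ENNReal.ofReal (343 * (18 * (|m| + 1) * mu)) *
        (eLpNorm F 2 volume * eLpNorm G 2 volume) := by
  rcases le_or_gt (40 * Real.pi * mu) lam₁ with hlam | hlam
  · have hlt : 1 < lam₁ := by nlinarith [Real.pi_gt_three]
    exact eLpNorm_indicator_waveConv_one_le_output_of_le hmu hlam hF (hFlow hlt) hG
  · have hmin : 2 * (|m| + 1) * min lam₁ lam₂ ≤ 343 * (18 * (|m| + 1) * mu) := by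
      have hlam' : lam₁ ≤ 160 * mu := by nlinarith [Real.pi_le_four]
      have hq : 0 ≤ |m| + 1 := by positivity
      nlinarith [min_le_left lam₁ lam₂]
    exact ((eLpNorm_indicator_le _).trans
      (eLpNorm_waveConv_le_min (Or.inl rfl) h₁ h₂ hF hG)).trans
        (mul_le_mul_left (ENNReal.ofReal_le_ofReal hmin) _)

end Estimates

end KleinGordon

end

open KleinGordon in
theorem lemma3p3_general (χ : Cutoff) (m : ℝ) :
    ∃ C : ℝ, 0 < C ∧ ∀ mu lam₁ lam₂ : ℝ, 1 ≤ mu → 1 ≤ lam₁ → 1 ≤ lam₂ →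
      ∀ f g : L2,
      (∀ ε : ℝ, ε = 1 ∨ ε = -1 →
        L2NormLe (interaction χ m mu ε (proj χ lam₁ f) (proj χ lam₂ g))
          (C * min lam₁ lam₂ * ‖proj χ lam₁ f‖ * ‖proj χ lam₂ g‖) ∧
        L2NormLe (interaction χ m mu ε (proj χ lam₁ f) (proj χ lam₂ g))
          (C * (mu ^ (1 / 2 : ℝ) * lam₁ ^ (1 / 2 : ℝ)) *
            ‖proj χ lam₁ f‖ * ‖proj χ lam₂ g‖)) ∧
      L2NormLe (interaction χ m mu 1 (proj χ lam₁ f) (proj χ lam₂ g))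
        (C * mu * ‖proj χ lam₁ f‖ * ‖proj χ lam₂ g‖) := by
  obtain ⟨B, hB, hχB⟩ := χ.exists_abs_rho_le
  set q : ℝ := |m / (2 * Real.pi)| + 1
  have : 0 < q := by positivity
  refine ⟨B * (343 * (18 * q)), by positivity, fun mu lam₁ lam₂ hmu h₁ h₂ f g => ?_⟩
  obtain ⟨F, hF, hFlow⟩ := exists_isProfile_proj χ m h₁ f
  obtain ⟨G, hG, -⟩ := exists_isProfile_proj χ m h₂ g
  have hF' := hF.toIsBandlimited
  have hG' := hG.toIsBandlimited
  have hconst {N X : ℝ} (hN : N ≤ 343 * (18 * q) * X) :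
      B * N * ‖proj χ lam₁ f‖ * ‖proj χ lam₂ g‖ ≤
        B * (343 * (18 * q)) * X * ‖proj χ lam₁ f‖ * ‖proj χ lam₂ g‖ := by
    rw [mul_assoc B _ X]
    gcongr
  refine ⟨fun ε hε => ⟨?_, ?_⟩, ?_⟩
  · refine (l2NormLe_interaction (hχB mu) hmu hF hG ((eLpNorm_indicator_le _).trans
      (eLpNorm_waveConv_le_min hε h₁ h₂ hF' hG'))).mono (hconst ?_)
    have hpos : 0 ≤ q * min lam₁ lam₂ := by positivity
    linarith
  · rw [← Real.sqrt_eq_rpow, ← Real.sqrt_eq_rpow]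
    refine (l2NormLe_interaction (hχB mu) hmu hF hG
      (eLpNorm_indicator_waveConv_le_sqrt hε hmu h₁ hF' hG')).mono (hconst ?_)
    have hpos : 0 ≤ q * (√mu * √lam₁) := by positivity
    linarith
  · exact (l2NormLe_interaction (hχB mu) hmu hF hG
      (eLpNorm_indicator_waveConv_one_le_output hmu h₁ h₂ hF' hFlow hG')).mono
        (hconst (by linarith))

theorem lemma3p3 (χ : KleinGordon.Cutoff) (m : ℝ) (hm : 0 ≤ m) (K : ℝ) (hK : 1 < K) :
    ∃ C : ℝ, 0 < C ∧ ∀ mu lam₁ lam₂ : ℝ,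
      KleinGordon.IsDyadic mu → KleinGordon.IsDyadic lam₁ → KleinGordon.IsDyadic lam₂ →
      1 ≤ mu → 1 ≤ lam₁ → 1 ≤ lam₂ → ∀ f g : KleinGordon.L2,
      -- (++) interaction
      ((K * lam₁ ≤ lam₂ ∨ K * lam₂ ≤ lam₁) →
        KleinGordon.L2NormLe
          (KleinGordon.interaction χ m mu 1
            (KleinGordon.proj χ lam₁ f) (KleinGordon.proj χ lam₂ g))
          (C * min lam₁ lam₂ *
            ‖KleinGordon.proj χ lam₁ f‖ * ‖KleinGordon.proj χ lam₂ g‖)) ∧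
      ((mu ≤ K * lam₁ ∧ lam₁ ≤ K * lam₂ ∧ lam₂ ≤ K * lam₁) →
        KleinGordon.L2NormLe
          (KleinGordon.interaction χ m mu 1
            (KleinGordon.proj χ lam₁ f) (KleinGordon.proj χ lam₂ g))
          (C * mu *
            ‖KleinGordon.proj χ lam₁ f‖ * ‖KleinGordon.proj χ lam₂ g‖)) ∧
      -- (+-) interaction
      ((K * lam₁ ≤ lam₂ ∨ K * lam₂ ≤ lam₁) →
        KleinGordon.L2NormLe
          (KleinGordon.interaction χ m mu (-1)
            (KleinGordon.proj χ lam₁ f) (KleinGordon.proj χ lam₂ g))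
          (C * min lam₁ lam₂ *
            ‖KleinGordon.proj χ lam₁ f‖ * ‖KleinGordon.proj χ lam₂ g‖)) ∧
      ((mu ≤ K * lam₁ ∧ lam₁ ≤ K * lam₂ ∧ lam₂ ≤ K * lam₁) →
        KleinGordon.L2NormLe
          (KleinGordon.interaction χ m mu (-1)
            (KleinGordon.proj χ lam₁ f) (KleinGordon.proj χ lam₂ g))
          (C * (mu ^ (1 / 2 : ℝ) * lam₁ ^ (1 / 2 : ℝ)) *
            ‖KleinGordon.proj χ lam₁ f‖ * ‖KleinGordon.proj χ lam₂ g‖)) := by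
  obtain ⟨C, hC, hbound⟩ := lemma3p3_general χ m
  refine ⟨C, hC, fun mu lam₁ lam₂ _ _ _ hmu h₁ h₂ f g => ?_⟩
  obtain ⟨hε, hout⟩ := hbound mu lam₁ lam₂ hmu h₁ h₂ f g
  exact ⟨fun _ => (hε 1 (Or.inl rfl)).1, fun _ => hout, fun _ => (hε (-1) (Or.inr rfl)).1,
    fun _ => (hε (-1) (Or.inr rfl)).2⟩
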